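/- Let $G$ and $H$ be groups. The (restricted) wreath product $G\wr H$ is the group of pairs $(f,h)$ with $h\in H$ and $f\colon H\to G$ of finite support, with multiplication $(f_1,h_1)(f_2,h_2)=(f,h_1h_2)$, where $f(a)=f_1(a)\,f_2(h_1^{-1}a)$. Let $K$ be a group with a finite symmetric generating set $\Sigma$. A knapsack expression over $K$ is a formal expression $E=v_0u_1^{x_1}v_1u_2^{x_2}v_2\cdots u_k^{x_k}v_k$ with $k\ge 0$, words $u_i,v_i\in\Sigma^*$ and pairwise distinct variables $x_1,\dots,x_k$. Its solution set $\mathsf{Sol}(E)\subseteq\mathbb{N}^k$ is the set of all $\nu\in\mathbb{N}^k$ such that the word $v_0u_1^{\nu_1}v_1\cdots u_k^{\nu_k}v_k$ represents the identity of $K$. A set $A\subseteq\mathbb{N}^k$ is linear if $A=\{w_0+\lambda_1w_1+\cdots+\lambda_nw_n\mid\lambda_1,\dots,\lambda_n\in\mathbb{N}\}$ for some $w_0,\dots,w_n\in\mathbb{N}^k$; the tuple $(w_0,\dots,w_n)$ is then a linear representation of $A$. A semilinear set is a finite union of linear sets, and a semilinear representation of it is a finite list of linear representations of linear sets with this union.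 A group $K$ is called knapsack-semilinear if it is finitely generated and, for some (equivalently, every) finite symmetric generating set $\Sigma$ of $K$, there is an algorithm (a computable function) that maps every knapsack expression $E$ over $K$, written as words over $\Sigma$, to a semilinear representation of $\mathsf{Sol}(E)$; in particular every $\mathsf{Sol}(E)$ is semilinear. **Theorem.** The group $G\wr H$ is knapsack-semilinear if and only if both $G$ and $H$ are knapsack-semilinear. -/

import Mathlib

universe u v

/-- The (restricted) wreath product `G ≀ H`, realised inside the unrestricted regular wreath
product: its elements are the pairs `(f, h)` with `h : H` and `f : H → G` of finite support,
multiplied by `(f₁, h₁) (f₂, h₂) = (a ↦ f₁ a * f₂ (h₁⁻¹ * a), h₁ * h₂)`. -/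
def restrictedWreathProduct (G : Type u) (H : Type v) [Group G] [Group H] :
    Subgroup (RegularWreathProduct G H) where
  carrier := {w | {h : H | w.left h ≠ 1}.Finite}
  one_mem' := by simp
  mul_mem' := by
    intro x y hx hy
    have hy' : ((fun h => x.right * h) '' {h : H | y.left h ≠ 1}).Finite := hy.image _
    refine (hx.union hy').subset ?_
    intro h hh
    by_contra hcon
    simp only [Set.mem_union, Set.mem_ofPred_eq, Set.mem_image, not_or, not_not, not_exists,
      not_and] at hcon
    apply hh
    have h2 : y.left (x.right⁻¹ * h) = 1 := by
      by_contra h3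
      exact hcon.2 _ h3 (by group)
    simp [hcon.1, h2]
  inv_mem' := by
    intro x hx
    have hx' : ((fun h => x.right⁻¹ * h) '' {h : H | x.left h ≠ 1}).Finite := hx.image _
    refine hx'.subset ?_
    intro h hh
    refine ⟨x.right * h, ?_, by group⟩
    intro h3
    apply hh
    simp [h3]

namespace Knapsack

/-- A word over an alphabet with `n` letters. -/
abbrev Word (n : ℕ) : Type := List (Fin n)

/-- The group element represented by a word, where the letter `i` stands for `a i`. -/
def evalWord {G : Type u} [Group G] {n : ℕ} (a : Fin n → G) (w : Word n) : G :=
  (w.map a).prod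

/-- `a 0, …, a (n-1)` is an enumeration of a finite symmetric generating set: the set is closed
under inversion, and every group element is represented by a word. -/
def IsSymmGenerating {G : Type u} [Group G] {n : ℕ} (a : Fin n → G) : Prop :=
  (∀ i, ∃ j, a j = (a i)⁻¹) ∧ ∀ g : G, ∃ w : Word n, evalWord a w = g

/-- A knapsack expression `v₀ u₁^{x₁} v₁ u₂^{x₂} v₂ ⋯ u_k^{x_k} v_k` with pairwise distinct
variables, given by `v₀` and the list of the pairs `(u₁, v₁), …, (u_k, v_k)`.
As the variables are pairwise distinct, they are identified with their positions. -/
abbrev Expr (n : ℕ) : Type := Word n × List (Word n × Word n)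

/-- The depth `k` of a knapsack expression. -/
abbrev depth {n : ℕ} (E : Expr n) : ℕ := E.2.length

/-- The word `ν(E) = v₀ u₁^{ν(x₁)} v₁ ⋯ u_k^{ν(x_k)} v_k`. -/
def subst {n : ℕ} (E : Expr n) (ν : Fin (depth E) → ℕ) : Word n :=
  E.1 ++ (List.ofFn fun i : Fin (depth E) =>
    (List.replicate (ν i) (E.2.get i).1).flatten ++ (E.2.get i).2).flatten

/-- The solution set of the equation `E = 1`. -/
def Sol {G : Type u} [Group G] {n : ℕ} (a : Fin n → G) (E : Expr n) :
    Set (Fin (depth E) → ℕ) :=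
  {ν | evalWord a (subst E ν) = 1}

/-- The vector of `ℕ^k` written as a list of numbers. (Lists are meant to have length `k`;
missing coordinates are read as `0` and superfluous ones are ignored.) -/
def vec (k : ℕ) (l : List ℕ) : Fin k → ℕ := fun i => l.getD i 0

/-- A linear representation `(v₀; v₁, …, v_m)`. -/
abbrev LinearRep : Type := List ℕ × List (List ℕ)

/-- The linear set `{v₀ + λ₁ v₁ + ⋯ + λ_m v_m | λ₁, …, λ_m ∈ ℕ} ⊆ ℕ^k`. -/
def LinearRep.set (k : ℕ) (L : LinearRep) : Set (Fin k → ℕ) :=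
  {x | ∃ c : Fin L.2.length → ℕ, x = vec k L.1 + ∑ j, c j • vec k (L.2.get j)}

/-- A semilinear representation: a finite list of linear representations. -/
abbrev SemilinearRep : Type := List LinearRep

/-- The semilinear subset of `ℕ^k` given by a semilinear representation. -/
def SemilinearRep.set (k : ℕ) (R : SemilinearRep) : Set (Fin k → ℕ) :=
  {x | ∃ L ∈ R, x ∈ LinearRep.set k L}

/-- With respect to the letters `a`, there is an algorithm that computes from every knapsack
expression a semilinear representation of its solution set. -/
def IsKnapsackSemilinearWith {G : Type u} [Group G] {n : ℕ} (a : Fin n → G) : Prop :=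
  ∃ f : Expr n → SemilinearRep, Computable f ∧
    ∀ E : Expr n, Sol a E = SemilinearRep.set (depth E) (f E)

/-- A group is knapsack-semilinear if it is finitely generated and a semilinear representation of
`Sol E` can be computed from a knapsack expression `E` written over a finite symmetric generating
set. The choice of the generating set does not matter, see
`IsKnapsackSemilinear.with_of_group`. -/
def IsKnapsackSemilinear (G : Type u) [Group G] : Prop :=
  ∃ (n : ℕ) (a : Fin n → G), IsSymmGenerating a ∧ IsKnapsackSemilinearWith a

theorem evalWord_append {G : Type u} [Group G] {n : ℕ} (a : Fin n → G) (w w' : Word n) :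
    evalWord a (w ++ w') = evalWord a w * evalWord a w' := by
  simp [evalWord]

theorem evalWord_flatten {G : Type u} [Group G] {n : ℕ} (a : Fin n → G) (l : List (Word n)) :
    evalWord a l.flatten = (l.map (evalWord a)).prod := by
  induction l with
  | nil => simp [evalWord]
  | cons w l ih => simp [evalWord_append, ih]

theorem mem_Sol_iff {G : Type u} [Group G] {n : ℕ} (a : Fin n → G) (E : Expr n)
    (ν : Fin (depth E) → ℕ) :
    ν ∈ Sol a E ↔ evalWord a E.1 * (List.ofFn fun i : Fin (depth E) =>
      evalWord a (E.2.get i).1 ^ ν i * evalWord a (E.2.get i).2).prod = 1 := by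
  simp only [Sol, subst, Set.mem_ofPred_eq, evalWord_append, evalWord_flatten, List.map_ofFn,
    Function.comp_def, List.map_replicate, List.prod_replicate]

theorem mem_set_cast {k k' : ℕ} (h : k' = k) (R : SemilinearRep) (ν : Fin k → ℕ) :
    ν ∈ SemilinearRep.set k R ↔ (fun i : Fin k' => ν (Fin.cast h i)) ∈ SemilinearRep.set k' R := by
  subst h
  rfl

/-- Knapsack-semilinearity does not depend on the generating set. -/
theorem IsKnapsackSemilinearWith.of_generating {G : Type u} [Group G] {n m : ℕ} {a : Fin n → G}
    (ha : IsKnapsackSemilinearWith a) (hgen : IsSymmGenerating a) (b : Fin m → G) :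
    IsKnapsackSemilinearWith b := by
  obtain ⟨f, hf, hsol⟩ := ha
  choose t ht using fun i => hgen.2 (b i)
  let φ : Word m → Word n := fun w => w.flatMap t
  have hφ : ∀ w, evalWord a (φ w) = evalWord b w := by
    intro w
    induction w with
    | nil => simp [φ, evalWord]
    | cons i w ih =>
      have h1 : φ (i :: w) = t i ++ φ w := by simp [φ]
      rw [h1, evalWord_append, ih, ht]
      simp [evalWord]
  let Φ : Expr m → Expr n := fun E => (φ E.1, E.2.map fun p => (φ p.1, φ p.2))
  have hφc : Primrec φ :=
    Primrec.list_flatMap Primrec.id ((Primrec.dom_finite t).comp Primrec.snd).to₂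
  have hΦc : Primrec Φ :=
    Primrec.pair (hφc.comp Primrec.fst) (Primrec.list_map Primrec.snd
      (Primrec.pair (hφc.comp (Primrec.fst.comp Primrec.snd))
        (hφc.comp (Primrec.snd.comp Primrec.snd))).to₂)
  refine ⟨fun E => f (Φ E), hf.comp hΦc.to_comp, fun E => ?_⟩
  have hk : depth (Φ E) = depth E := by simp [Φ, depth]
  ext ν
  rw [mem_set_cast hk, ← hsol (Φ E), mem_Sol_iff, mem_Sol_iff, List.ofFn_congr hk]
  simp only [Φ, hφ, List.get_eq_getElem, List.getElem_map, Fin.val_cast]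
  rfl

/-- In a knapsack-semilinear group, solution sets are computable over every finite family of
letters, in particular over every finite symmetric generating set. -/
theorem IsKnapsackSemilinear.with_of_group {G : Type u} [Group G] (h : IsKnapsackSemilinear G)
    {m : ℕ} (b : Fin m → G) : IsKnapsackSemilinearWith b := by
  obtain ⟨n, a, hgen, ha⟩ := h
  exact ha.of_generating hgen b

end Knapsack

/-!
The theorem rests on a finitary description of Presburger-definable sets. Call two tuples of natural
numbers equivalent at level `M` (`Knapsack.PresEquiv`) if they satisfy the same linear inequalities
with coefficients bounded by `M` and are congruent modulo all `m ≤ M`. An equivalence of level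
`step M` can be extended by one coordinate to an equivalence of level `M`, with a bound on the new
coordinate (`PresEquiv.forth_bounded`). Hence sets that are invariant at level `M` are semilinear,
and two of them coincide as soon as they agree on explicitly bounded tuples
(`Invariant.isSemilinearSet`, `Invariant.eq_of_bounded`); conversely a semilinear set is invariant
at a level computable from a representation (`invariant_semilinearRep`).

Consequently a finitely generated group with solvable word problem is knapsack-semilinear if and only if it is
*tame*: the solution sets of equations `g₀ ^ x₀ ⋯ = 1` are invariant at a level computable from the
size of the equation. For one direction, the levels of the finitely many equations of a given size
are summed up (`IsKnapsackSemilinearWith.exists_tame`); the other one searches for a representation,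
whose correctness is decidable (`Tame.isKnapsackSemilinearWith`).

Tameness passes from `G` and `H` to the wreath product (`Tame.wreath`). After division of the
exponents by a common torsion exponent of the elements of `H` involved, every power `w ^ x` has
exponent `1`, or its right component is trivial or of infinite order. A position with a nontrivial
value is a product of powers in `H` with one additional exponent (`exists_position`), so
back-and-forth provides a corresponding position for an equivalent tuple of exponents. At
corresponding positions the two values are one and the same product of powers in `G`
(`exists_common_values`): a power with trivial right component contributes a power in `G`, and a
power with right component of infinite order visits the support boundedly often, so its contribution
can be matched visit by visit (`prod_range_eq_of_presEquiv`). Tameness of `G` then finishes the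
argument. In the other direction, `G` and `H` are finitely generated subgroups of
the wreath product.
-/

namespace Knapsack

/-! ### Presburger equivalence of tuples -/

/-- Two tuples of natural numbers are equivalent at level `M` if they satisfy the same linear
inequalities with coefficients and constant bounded by `M`, and are congruent modulo every
`m ∈ {1, …, M}`. -/
structure PresEquiv {ι : Type} [Fintype ι] (M : ℕ) (a b : ι → ℕ) : Prop where
  le_iff : ∀ (l : ι → ℤ) (c : ℤ), (∀ i, |l i| ≤ M) → |c| ≤ M →
    (∑ i, l i * (a i : ℤ) ≤ c ↔ ∑ i, l i * (b i : ℤ) ≤ c)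
  modEq : ∀ m, 1 ≤ m → m ≤ M → ∀ i, a i ≡ b i [MOD m]

namespace PresEquiv

variable {ι κ : Type} [Fintype ι] [Fintype κ] {M N : ℕ} {a b : ι → ℕ}

theorem refl (M : ℕ) (a : ι → ℕ) : PresEquiv M a a :=
  ⟨fun _ _ _ _ => Iff.rfl, fun _ _ _ _ => rfl⟩

theorem symm (h : PresEquiv M a b) : PresEquiv M b a :=
  ⟨fun l c hl hc => (h.le_iff l c hl hc).symm, fun m h1 h2 i => (h.modEq m h1 h2 i).symm⟩

theorem mono (h : PresEquiv N a b) (hMN : M ≤ N) : PresEquiv M a b := by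
  have hMN' : (M : ℤ) ≤ N := by exact_mod_cast hMN
  exact ⟨fun l c hl hc => h.le_iff l c (fun i => (hl i).trans hMN') (hc.trans hMN'),
    fun m h1 h2 i => h.modEq m h1 (h2.trans hMN) i⟩

theorem eq_iff (h : PresEquiv M a b) (l : ι → ℤ) (c : ℤ) (hl : ∀ i, |l i| ≤ M) (hc : |c| ≤ M) :
    ∑ i, l i * (a i : ℤ) = c ↔ ∑ i, l i * (b i : ℤ) = c := by
  have h1 := h.le_iff l c hl hc
  have h2 := h.le_iff (fun i => - l i) (-c) (fun i => by simpa using hl i) (by simpa using hc)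
  simp only [neg_mul, Finset.sum_neg_distrib, neg_le_neg_iff] at h2
  rw [le_antisymm_iff, le_antisymm_iff, h1, h2]

/-- Substituting affine forms with natural coefficients bounded by `K` into the coordinates. -/
theorem affine (K : ℕ) (A : κ → ι → ℕ) (B : κ → ℕ) (hA : ∀ j i, A j i ≤ K) (hB : ∀ j, B j ≤ K)
    (h : PresEquiv (M * (1 + Fintype.card κ * K)) a b) :
    PresEquiv M (fun j => ∑ i, A j i * a i + B j) (fun j => ∑ i, A j i * b i + B j) := by
  constructor
  · intro l c hl hc
    have key : ∀ x : ι → ℕ, (∑ j, l j * ((∑ i, A j i * x i + B j : ℕ) : ℤ) ≤ c ↔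
        ∑ i, (∑ j, l j * A j i) * (x i : ℤ) ≤ c - ∑ j, l j * B j) := by
      intro x
      have : ∑ j, l j * ((∑ i, A j i * x i + B j : ℕ) : ℤ) =
          ∑ i, (∑ j, l j * A j i) * (x i : ℤ) + ∑ j, l j * B j := by
        push_cast
        simp only [mul_add, Finset.sum_add_distrib, Finset.mul_sum, Finset.sum_mul]
        rw [Finset.sum_comm]
        simp only [mul_assoc]
      rw [this]
      constructor <;> intro h <;> linarith
    have bd : ∀ f : κ → ℕ, (∀ j, f j ≤ K) → |∑ j, l j * (f j : ℤ)| ≤ M * (Fintype.card κ * K) := by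
      intro f hf
      calc |∑ j, l j * (f j : ℤ)| ≤ ∑ j, |l j * (f j : ℤ)| := Finset.abs_sum_le_sum_abs _ _
        _ ≤ ∑ _j : κ, (M * K : ℤ) := by
          refine Finset.sum_le_sum fun j _ => ?_
          rw [abs_mul, Nat.abs_cast]
          exact mul_le_mul (hl j) (by exact_mod_cast hf j) (by positivity) (by positivity)
        _ = M * (Fintype.card κ * K) := by simp; ring
    rw [key, key]
    refine h.le_iff _ _ (fun i => ?_) ?_
    · refine (bd (fun j => A j i) (fun j => hA j i)).trans ?_
      push_cast
      nlinarith [(Nat.cast_nonneg M : (0 : ℤ) ≤ M)]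
    · refine (abs_sub _ _).trans ?_
      have := bd B hB
      push_cast
      linarith
  · intro m h1 h2 j
    refine Nat.ModEq.add_right _ ?_
    have hm : m ≤ M * (1 + Fintype.card κ * K) :=
      h2.trans (Nat.le_mul_of_pos_right _ (by positivity))
    rw [← ZMod.natCast_eq_natCast_iff]
    push_cast
    refine Finset.sum_congr rfl fun i _ => ?_
    rw [(ZMod.natCast_eq_natCast_iff _ _ _).2 (h.modEq m h1 hm i)]

/-- Reading coordinates through a map; coordinates sent to `none` are set to `1`. -/
theorem elim_one (e : κ → Option ι) (h : PresEquiv (M * (1 + Fintype.card κ)) a b) :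
    PresEquiv M (fun j => (e j).elim 1 a) (fun j => (e j).elim 1 b) := by
  classical
  have := affine (M := M) (a := a) (b := b) 1 (fun j i => if e j = some i then 1 else 0)
    (fun j => if e j = none then 1 else 0)
    (fun j i => by split_ifs <;> simp) (fun j => by split_ifs <;> simp) (by simpa using h)
  have key : ∀ x : ι → ℕ, (fun j => ∑ i, (if e j = some i then 1 else 0) * x i +
      (if e j = none then 1 else 0)) = fun j => (e j).elim 1 x := by
    intro x
    funext j
    cases h : e j <;> simp
  rwa [key, key] at this

theorem comp_injective (e : κ → ι) (he : Function.Injective e) (h : PresEquiv M a b) :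
    PresEquiv M (a ∘ e) (b ∘ e) := by
  classical
  constructor
  · intro l c hl hc
    have key : ∀ x : ι → ℕ, ∑ j, l j * ((x ∘ e) j : ℤ) =
        ∑ i, (Function.extend e l 0 i) * (x i : ℤ) := by
      intro x
      rw [← Finset.sum_subset (Finset.subset_univ (Finset.univ.image e)),
        Finset.sum_image (fun _ _ _ _ h => he h)]
      · simp [he.extend_apply]
      · intro i _ hi
        rw [Function.extend_apply']
        · simp
        · rintro ⟨j, rfl⟩
          simp at hi
    rw [key, key]
    refine h.le_iff _ _ (fun i => ?_) hc
    by_cases hi : ∃ j, e j = i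
    · obtain ⟨j, rfl⟩ := hi
      rw [he.extend_apply]
      exact hl j
    · rw [Function.extend_apply' _ _ _ hi]
      simp
  · intro m h1 h2 j
    exact h.modEq m h1 h2 (e j)

end PresEquiv

/-- The tuple `x` extended by one more coordinate `y`. -/
def snoc {ι : Type} (x : ι → ℕ) (y : ℕ) : Option ι → ℕ := fun o => o.elim y x

@[simp] theorem snoc_none {ι : Type} (x : ι → ℕ) (y : ℕ) : snoc x y none = y := rfl
@[simp] theorem snoc_some {ι : Type} (x : ι → ℕ) (y : ℕ) (i : ι) : snoc x y (some i) = x i := rfl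

/-- The level needed so that an equivalence can be extended by one coordinate to an equivalence
of level `M`. -/
def step (M : ℕ) : ℕ := (M.factorial) ^ 2 + 2 * M * M.factorial + 2

theorem le_step (M : ℕ) : M ≤ step M := by
  unfold step
  nlinarith [M.factorial_pos, Nat.self_le_factorial M]

theorem step_mono : Monotone step := by
  intro M N h
  unfold step
  have := Nat.factorial_le h
  gcongr

theorem le_iterate_step (n M : ℕ) : M ≤ step^[n] M :=
  Function.id_le_iterate_of_id_le le_step n M

theorem iterate_step_le {m n M : ℕ} (h : m ≤ n) : step^[m] M ≤ step^[n] M :=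
  Function.monotone_iterate_of_id_le le_step h M

/-- The back-and-forth property of Presburger equivalence, with a bound for the new coordinate. -/
theorem PresEquiv.forth_bounded {ι : Type} [Fintype ι] {M : ℕ} {a b : ι → ℕ}
    (h : PresEquiv (step M) a b) (y : ℕ) :
    ∃ y', PresEquiv M (snoc a y) (snoc b y') ∧ y' ≤ step M * (1 + ∑ i, b i) := by
  set D : ℕ := M.factorial with hD
  have hD0 : 0 < D := Nat.factorial_pos M
  have hDM : M ≤ D := Nat.self_le_factorial M
  have hDz : (1 : ℤ) ≤ D := by exact_mod_cast hD0
  have hM0 : (0 : ℤ) ≤ M := by positivity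
  have hstep : ((step M : ℕ) : ℤ) = (D : ℤ) ^ 2 + 2 * M * D + 2 := by
    simp [step, hD]
  -- The values at `a` of the bounded linear forms that are at most `D * y`.
  let P : ℤ → Prop := fun z => z ≤ D * y ∧ ∃ (l : ι → ℤ) (c : ℤ), (∀ i, |l i| ≤ M * D) ∧
    |c| ≤ M * D + 1 ∧ z = ∑ i, l i * (a i : ℤ) + c
  obtain ⟨z, ⟨hz, l₀, c₀, hl₀, hc₀, rfl⟩, hmax⟩ : ∃ ub, P ub ∧ ∀ z, P z → z ≤ ub :=
    Int.exists_greatest_of_bdd ⟨D * y, fun z hz => hz.1⟩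
      ⟨0, by positivity, 0, 0, by simp only [Pi.zero_apply, abs_zero]; intro; positivity,
        by simp only [abs_zero]; positivity, by simp⟩
  -- Comparing any bounded form with the chosen one transfers from `a` to `b`.
  have cmp : ∀ (l : ι → ℤ) (c e : ℤ), (∀ i, |l i| ≤ M * D) → |c| ≤ M * D + 1 → 0 ≤ e →
      e ≤ D ^ 2 →
      (∑ i, l i * (a i : ℤ) + c ≤ ∑ i, l₀ i * (a i : ℤ) + c₀ + e ↔
        ∑ i, l i * (b i : ℤ) + c ≤ ∑ i, l₀ i * (b i : ℤ) + c₀ + e) := by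
    intro l c e hl hc he0 he
    have key : ∀ x : ι → ℕ, (∑ i, l i * (x i : ℤ) + c ≤ ∑ i, l₀ i * (x i : ℤ) + c₀ + e ↔
        ∑ i, (l i - l₀ i) * (x i : ℤ) ≤ c₀ - c + e) := by
      intro x
      simp only [sub_mul, Finset.sum_sub_distrib]
      constructor <;> intro h <;> linarith
    rw [key, key]
    refine h.le_iff _ _ (fun i => ?_) ?_
    · refine (abs_sub _ _).trans ?_
      rw [hstep]
      nlinarith [hl i, hl₀ i]
    · rw [hstep, abs_le]
      rw [abs_le] at hc hc₀
      constructor <;> nlinarith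
  set ta : ℤ := ∑ i, l₀ i * (a i : ℤ) + c₀ with hta
  set tb : ℤ := ∑ i, l₀ i * (b i : ℤ) + c₀ with htb
  have htb0 : 0 ≤ tb := by
    have h0 : (0 : ℤ) ≤ ta := hmax 0 ⟨by positivity, 0, 0,
      by simp only [Pi.zero_apply, abs_zero]; intro; positivity,
      by simp only [abs_zero]; positivity, by simp⟩
    have := (cmp 0 0 0 (by simp only [Pi.zero_apply, abs_zero]; intro; positivity)
      (by simp only [abs_zero]; positivity) le_rfl (by positivity)).1
      (by simpa using h0)
    simpa using this
  set e : ℤ := D * y - ta with he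
  have he0 : 0 ≤ e := by simp only [he]; linarith
  have hD2 : (0 : ℤ) < (D : ℤ) ^ 2 := by positivity
  -- The gap above the chosen form is kept if it is small, and reduced modulo `D ^ 2` otherwise.
  obtain ⟨e', he'0, he'D, hmod, hsmall⟩ : ∃ e' : ℤ, 0 ≤ e' ∧ e' ≤ (D : ℤ) ^ 2 ∧
      (D : ℤ) ^ 2 ∣ e' - e ∧ (e ≤ (D : ℤ) ^ 2 → e' = e) := by
    by_cases hc : e ≤ (D : ℤ) ^ 2
    · exact ⟨e, he0, hc, by simp, fun _ => rfl⟩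
    · refine ⟨e % (D : ℤ) ^ 2, Int.emod_nonneg _ hD2.ne', (Int.emod_lt_of_pos _ hD2).le, ?_,
        fun h => absurd h hc⟩
      exact (Int.mod_modEq e _).symm.dvd
  have hcong : (D : ℤ) ^ 2 ∣ tb - ta := by
    have : tb - ta = ∑ i, l₀ i * ((b i : ℤ) - a i) := by
      simp only [hta, htb, mul_sub, Finset.sum_sub_distrib]
      ring
    rw [this]
    refine Finset.dvd_sum fun i _ => Dvd.dvd.mul_left ?_ _
    have h1 := h.modEq (D ^ 2) (Nat.one_le_pow _ _ hD0) (by rw [step, ← hD]; lia) i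
    simpa using (Int.natCast_modEq_iff.2 h1).dvd
  obtain ⟨k, hk⟩ : (D : ℤ) ^ 2 ∣ (tb + e') - D * y := by
    have : (tb + e') - D * y = (tb - ta) + (e' - e) := by simp only [he]; ring
    rw [this]
    exact dvd_add hcong hmod
  have hy'0 : 0 ≤ (y : ℤ) + D * k := by
    by_contra hneg
    have : (D : ℤ) * (y + D * k) = tb + e' := by linarith
    nlinarith
  obtain ⟨y', hy'⟩ := Int.eq_ofNat_of_zero_le hy'0
  have hDy' : (D : ℤ) * y' = tb + e' := by rw [← hy']; linarith
  have hDy : (D : ℤ) * y = ta + e := by simp only [he]; ring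
  -- Comparisons of `D * y` with bounded forms transfer to `D * y'`.
  have main : ∀ (l : ι → ℤ) (c : ℤ), (∀ i, |l i| ≤ M * D) → |c| ≤ M * D + 1 →
      (∑ i, l i * (a i : ℤ) + c ≤ D * y ↔ ∑ i, l i * (b i : ℤ) + c ≤ D * y') := by
    intro l c hl hc
    rw [hDy', hDy]
    by_cases hcase : e ≤ (D : ℤ) ^ 2
    · rw [hsmall hcase]
      exact cmp l c e hl hc he0 hcase
    · constructor
      · intro hle
        have h1 := hmax _ ⟨hle.trans hDy.ge, l, c, hl, hc, rfl⟩
        have h2 := (cmp l c 0 hl hc le_rfl (by positivity)).1 (by simpa using h1)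
        linarith
      · intro hle
        have h2 := (cmp l c (D ^ 2) hl hc (by positivity) le_rfl).2 (by linarith)
        linarith
  refine ⟨y', ⟨?_, ?_⟩, ?_⟩
  · intro L c hL hc
    simp only [Fintype.sum_option, snoc_none, snoc_some]
    set μ := L none with hμ
    have hμM := hL none
    rw [← hμ] at hμM
    rcases eq_or_ne μ 0 with h0 | h0
    · have hMs : (M : ℤ) ≤ step M := by exact_mod_cast le_step M
      simpa [h0] using h.le_iff (fun i => L (some i)) c (fun i => (hL _).trans hMs) (hc.trans hMs)
    obtain ⟨ν, hν⟩ : |μ| ∣ (D : ℤ) := by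
      rw [Int.abs_eq_natAbs]
      refine Int.natCast_dvd_natCast.2 (Nat.dvd_factorial (Int.natAbs_pos.2 h0) ?_)
      zify
      exact hμM
    have hμ0 : 0 < |μ| := abs_pos.2 h0
    have hν0 : 0 < ν := by
      by_contra hneg
      nlinarith
    have hνD : ν ≤ D := by nlinarith
    have hb1 : ∀ i, |ν * L (some i)| ≤ M * D := fun i => by
      rw [abs_mul, abs_of_pos hν0, mul_comm]
      exact mul_le_mul (hL _) hνD hν0.le hM0
    have hb2 : |ν * c| ≤ M * D := by
      rw [abs_mul, abs_of_pos hν0, mul_comm]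
      exact mul_le_mul hc hνD hν0.le hM0
    rcases lt_or_gt_of_ne h0 with hneg | hpos
    · -- A negative coefficient of the new coordinate gives a lower bound for it.
      have h1 := main (fun i => ν * L (some i)) (-(ν * c)) hb1 (by rw [abs_neg]; linarith)
      have key : ∀ (x : ι → ℕ) (t : ℕ), (μ * t + ∑ i, L (some i) * (x i : ℤ) ≤ c ↔
          ∑ i, ν * L (some i) * (x i : ℤ) + -(ν * c) ≤ D * t) := by
        intro x t
        rw [hν, abs_of_neg hneg]
        simp only [mul_assoc, ← Finset.mul_sum]
        rw [← mul_le_mul_iff_of_pos_left hν0]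
        constructor <;> intro h <;> linarith
      rw [key, key, h1]
    · -- A positive coefficient gives an upper bound, the negation of a lower bound.
      have h1 := main (fun i => -(ν * L (some i))) (ν * c + 1) (by simpa using hb1) (by
        refine (abs_add_le _ _).trans ?_
        rw [abs_one]
        linarith)
      have key : ∀ (x : ι → ℕ) (t : ℕ), (μ * t + ∑ i, L (some i) * (x i : ℤ) ≤ c ↔
          ¬ (∑ i, -(ν * L (some i)) * (x i : ℤ) + (ν * c + 1) ≤ D * t)) := by
        intro x t
        rw [hν, abs_of_pos hpos, not_le]
        simp only [neg_mul, mul_assoc, ← Finset.mul_sum, Finset.sum_neg_distrib]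
        rw [← mul_le_mul_iff_of_pos_left hν0]
        constructor <;> intro h <;> linarith
      rw [key, key, h1]
  · intro m h1 h2 o
    cases o with
    | none =>
      have hmD : m ∣ D := Nat.dvd_factorial h1 h2
      rw [snoc_none, snoc_none, ← Int.natCast_modEq_iff]
      rw [Int.modEq_iff_dvd]
      have : (y' : ℤ) - y = D * k := by rw [← hy']; ring
      rw [this]
      exact Dvd.dvd.mul_right (Int.natCast_dvd_natCast.2 hmD) _
    | some i => exact h.modEq m h1 (h2.trans (le_step M)) i
  · have hs : ∑ i, l₀ i * (b i : ℤ) ≤ (M * D) * ∑ i, (b i : ℤ) := by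
      rw [Finset.mul_sum]
      exact Finset.sum_le_sum fun i _ =>
        mul_le_mul_of_nonneg_right ((le_abs_self _).trans (hl₀ i)) (by positivity)
    have hc := (le_abs_self _).trans hc₀
    have hS : (0 : ℤ) ≤ ∑ i, (b i : ℤ) := by positivity
    have h1 : (y' : ℤ) ≤ D * y' := by nlinarith [(Nat.cast_nonneg y' : (0 : ℤ) ≤ y')]
    have hMD : (0 : ℤ) ≤ M * D := by positivity
    zify
    rw [hstep]
    nlinarith [mul_nonneg hD2.le hS, mul_nonneg hMD hS]

theorem PresEquiv.forth {ι : Type} [Fintype ι] {M : ℕ} {a b : ι → ℕ}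
    (h : PresEquiv (step M) a b) (y : ℕ) : ∃ y', PresEquiv M (snoc a y) (snoc b y') :=
  (h.forth_bounded y).imp fun _ h => h.1

/-- Back-and-forth for several new coordinates at once. -/
theorem PresEquiv.forth_tuple {ι : Type} [Fintype ι] {M : ℕ} {a b : ι → ℕ} (n : ℕ)
    (h : PresEquiv (step^[n] M) a b) (c : Fin n → ℕ) :
    ∃ c' : Fin n → ℕ, PresEquiv M (Sum.elim a c) (Sum.elim b c') := by
  induction n generalizing M with
  | zero =>
    refine ⟨c, ?_⟩
    have := h.comp_injective (fun s : ι ⊕ Fin 0 => s.elim id (fun i => i.elim0))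
      (by rintro (i | i) (j | j) hij <;> first | exact i.elim0 | exact j.elim0 | simpa using hij)
    have key : ∀ x : ι → ℕ, Sum.elim x c =
        x ∘ (fun s : ι ⊕ Fin 0 => s.elim id (fun i => i.elim0)) := by
      intro x
      funext s
      rcases s with i | i
      · rfl
      · exact i.elim0
    rw [key, key]
    exact this
  | succ n ih =>
    obtain ⟨c', hc'⟩ := ih (M := step M) (by simpa using h) (fun i => c i.castSucc)
    obtain ⟨y', hy'⟩ := hc'.forth (c (Fin.last n))
    refine ⟨Fin.snoc c' y', ?_⟩
    let e : ι ⊕ Fin (n + 1) → Option (ι ⊕ Fin n) := fun s =>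
      s.elim (fun i => some (Sum.inl i))
        (fun j => Fin.lastCases (motive := fun _ => Option (ι ⊕ Fin n)) none
          (fun j => some (Sum.inr j)) j)
    have he : Function.Injective e := by
      rintro (i | i) (j | j) hij
      · simpa [e] using hij
      · cases j using Fin.lastCases <;> simp [e] at hij
      · cases i using Fin.lastCases <;> simp [e] at hij
      · cases i using Fin.lastCases <;> cases j using Fin.lastCases <;> simp_all [e]
    have := hy'.comp_injective e he
    convert this using 1 <;>
    · funext s
      rcases s with i | i
      · rfl
      · cases i using Fin.lastCases <;> simp [e]

/-- A bound for the entries of suitable representatives of the equivalence classes of level `M` of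
tuples of length `k`. -/
def repBound (k M : ℕ) : ℕ :=
  Nat.rec 0 (fun _ b => b + step^[k] M * (1 + k * b)) k

theorem exists_bounded_rep (k M : ℕ) (x : Fin k → ℕ) :
    ∃ x' : Fin k → ℕ, PresEquiv M x x' ∧ ∀ i, x' i ≤ repBound k M := by
  let B : ℕ → ℕ := fun j => Nat.rec 0 (fun _ b => b + step^[k] M * (1 + k * b)) j
  have key : ∀ (j : ℕ), j ≤ k → ∀ (M' : ℕ), step^[j] M' ≤ step^[k] M → ∀ x : Fin j → ℕ,
      ∃ x' : Fin j → ℕ, PresEquiv M' x x' ∧ ∀ i, x' i ≤ B j := by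
    intro j
    induction j with
    | zero => exact fun _ M' _ x => ⟨x, .refl _ _, fun i => i.elim0⟩
    | succ j ih =>
      intro hj M' hM' x
      obtain ⟨x', hx', hb⟩ := ih (by omega) (step M') (by simpa using hM') (fun i => x i.castSucc)
      obtain ⟨y', hy', hyb⟩ := hx'.forth_bounded (x (Fin.last j))
      refine ⟨Fin.snoc x' y', ?_, ?_⟩
      · let e : Fin (j + 1) → Option (Fin j) :=
          fun i => Fin.lastCases (motive := fun _ => Option (Fin j)) none (fun i => some i) i
        have he : Function.Injective e := by
          intro i i' hii
          cases i using Fin.lastCases <;> cases i' using Fin.lastCases <;> simp_all [e]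
        have := hy'.comp_injective e he
        convert this using 1 <;>
        · funext i
          cases i using Fin.lastCases <;> simp [e]
      · have hBs : B (j + 1) = B j + step^[k] M * (1 + k * B j) := rfl
        intro i
        cases i using Fin.lastCases with
        | cast i => simpa using (hb i).trans (by omega)
        | last =>
          have h1 : step M' ≤ step^[k] M := by
            refine le_trans ?_ hM'
            rw [Function.iterate_succ_apply]
            exact le_iterate_step _ _
          have h2 : ∑ i, x' i ≤ k * B j := by
            refine (Finset.sum_le_card_nsmul _ _ _ fun i _ => hb i).trans ?_
            simp only [Finset.card_univ, Fintype.card_fin, smul_eq_mul]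
            gcongr
            omega
          have h3 : y' ≤ step^[k] M * (1 + k * B j) := hyb.trans (by gcongr)
          simp only [Fin.snoc_last]
          omega
  exact key k le_rfl M le_rfl x

/-! ### Invariant sets are semilinear -/

open Pointwise in
theorem isSemilinearSet_Iic (c : ℤ) : IsSemilinearSet (Set.Iic c) := by
  have : Set.Iic c = (fun n : ℕ => c - n) '' Set.univ := by
    ext z
    simp only [Set.mem_Iic, Set.image_univ, Set.mem_range]
    exact ⟨fun h => ⟨(c - z).toNat, by omega⟩, by rintro ⟨n, rfl⟩; omega⟩
  have h2 : Set.Iic c = ({c} : Set ℤ) +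
      (fun n : ℕ => -(n : ℤ)) '' Set.univ := by
    rw [this, Set.singleton_add, Set.image_image]
    rfl
  rw [h2]
  refine (IsSemilinearSet.singleton c).add ?_
  exact IsSemilinearSet.image (IsSemilinearSet.univ (M := ℕ)) (-(Nat.castAddMonoidHom ℤ))

theorem isSemilinearSet_presEquiv {ι : Type} [Fintype ι] (M : ℕ) (a : ι → ℕ) :
    IsSemilinearSet {b | PresEquiv M a b} := by
  classical
  let F : Finset ((ι → ℤ) × ℤ) :=
    (Fintype.piFinset fun _ => Finset.Icc (-(M : ℤ)) M) ×ˢ Finset.Icc (-(M : ℤ)) M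
  let lin : (ι → ℤ) → ((ι → ℕ) →+ ℤ) := fun l =>
    { toFun := fun x => ∑ i, l i * (x i : ℤ)
      map_zero' := by simp
      map_add' := fun x y => by simp [mul_add, Finset.sum_add_distrib] }
  have hle : ∀ p : (ι → ℤ) × ℤ, IsSemilinearSet
      {b : ι → ℕ | ∑ i, p.1 i * (a i : ℤ) ≤ p.2 ↔ ∑ i, p.1 i * (b i : ℤ) ≤ p.2} := by
    intro p
    have h : IsSemilinearSet {b : ι → ℕ | ∑ i, p.1 i * (b i : ℤ) ≤ p.2} :=
      (isSemilinearSet_Iic p.2).preimage (lin p.1)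
    by_cases ha : ∑ i, p.1 i * (a i : ℤ) ≤ p.2
    · simpa [ha] using h
    · simp only [ha, false_iff]
      exact h.compl
  have hmod : ∀ q : ℕ × ι, IsSemilinearSet {b : ι → ℕ | a q.2 ≡ b q.2 [MOD q.1]} := by
    intro q
    have h : IsSemilinearSet ({((a q.2 : ℕ) : ZMod q.1)} : Set (ZMod q.1)) :=
      IsSemilinearSet.singleton _
    convert h.preimage ((Nat.castAddMonoidHom (ZMod q.1)).comp
      (Pi.evalAddMonoidHom (fun _ => ℕ) q.2)) using 1
    ext b
    simp [← ZMod.natCast_eq_natCast_iff, eq_comm]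
  have : {b | PresEquiv M a b} =
      (⋂ p ∈ F, {b : ι → ℕ | ∑ i, p.1 i * (a i : ℤ) ≤ p.2 ↔ ∑ i, p.1 i * (b i : ℤ) ≤ p.2}) ∩
      ⋂ q ∈ Finset.Icc 1 M ×ˢ (Finset.univ : Finset ι), {b : ι → ℕ | a q.2 ≡ b q.2 [MOD q.1]} := by
    ext b
    simp only [Set.mem_ofPred_eq, Set.mem_inter_iff, Set.mem_iInter, F, Finset.mem_product,
      Fintype.mem_piFinset, Finset.mem_Icc, Finset.mem_univ, and_true, ← abs_le]
    exact ⟨fun h => ⟨fun p hp => h.le_iff p.1 p.2 hp.1 hp.2,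
      fun q hq => h.modEq q.1 hq.1 hq.2 q.2⟩,
      fun h => ⟨fun l c hl hc => h.1 (l, c) ⟨hl, hc⟩, fun m h1 h2 i => h.2 (m, i) ⟨h1, h2⟩⟩⟩
  rw [this]
  exact (IsSemilinearSet.biInter_finset fun p _ => hle p).inter
    (IsSemilinearSet.biInter_finset fun q _ => hmod q)

/-- A set is invariant at level `M` if it is a union of equivalence classes of `PresEquiv M`. -/
def Invariant {ι : Type} [Fintype ι] (M : ℕ) (S : Set (ι → ℕ)) : Prop :=
  ∀ a b, PresEquiv M a b → a ∈ S → b ∈ S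

theorem Invariant.mono {ι : Type} [Fintype ι] {M N : ℕ} {S : Set (ι → ℕ)} (h : Invariant M S)
    (hMN : M ≤ N) : Invariant N S :=
  fun a b hab => h a b (hab.mono hMN)

theorem Invariant.mem_iff {ι : Type} [Fintype ι] {M : ℕ} {S : Set (ι → ℕ)} (h : Invariant M S)
    {a b : ι → ℕ} (hab : PresEquiv M a b) : a ∈ S ↔ b ∈ S :=
  ⟨h a b hab, h b a hab.symm⟩

theorem Invariant.isSemilinearSet {k M : ℕ} {S : Set (Fin k → ℕ)} (h : Invariant M S) :
    IsSemilinearSet S := by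
  have hfin : {a : Fin k → ℕ | a ∈ S ∧ ∀ i, a i ≤ repBound k M}.Finite := by
    refine (Set.finite_Iic (fun _ : Fin k => repBound k M)).subset fun a ha => ?_
    exact fun i => ha.2 i
  have : S = ⋃ a ∈ {a : Fin k → ℕ | a ∈ S ∧ ∀ i, a i ≤ repBound k M}, {b | PresEquiv M a b} := by
    ext b
    simp only [Set.mem_ofPred_eq, Set.mem_iUnion, exists_prop]
    constructor
    · intro hb
      obtain ⟨a, hab, ha⟩ := exists_bounded_rep k M b
      exact ⟨a, ⟨h _ _ hab hb, ha⟩, hab.symm⟩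
    · rintro ⟨a, ⟨ha, -⟩, hab⟩
      exact h _ _ hab ha
  rw [this]
  exact IsSemilinearSet.biUnion hfin fun a _ => isSemilinearSet_presEquiv M a

theorem Invariant.eq_of_bounded {k M : ℕ} {S T : Set (Fin k → ℕ)} (hS : Invariant M S)
    (hT : Invariant M T) (h : ∀ x, (∀ i, x i ≤ repBound k M) → (x ∈ S ↔ x ∈ T)) : S = T := by
  ext x
  obtain ⟨y, hxy, hy⟩ := exists_bounded_rep k M x
  rw [hS.mem_iff hxy, hT.mem_iff hxy, h y hy]

/-! ### Semilinear representations -/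

theorem vec_ofFn {k : ℕ} (x : Fin k → ℕ) : vec k (List.ofFn x) = x := by
  funext i
  simp [vec, List.getD_eq_getElem?_getD]

theorem exists_linearRep {k : ℕ} {S : Set (Fin k → ℕ)} (h : IsLinearSet S) :
    ∃ L : LinearRep, LinearRep.set k L = S := by
  obtain ⟨v, n, A, rfl⟩ := Nat.isLinearSet_iff_exists_matrix.1 h
  refine ⟨(List.ofFn v, List.ofFn fun j => List.ofFn fun i => A i j), ?_⟩
  ext x
  simp only [LinearRep.set, Set.mem_ofPred_eq, vec_ofFn]
  have hlen : (List.ofFn fun j => List.ofFn fun i => A i j).length = n := by simp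
  constructor
  · rintro ⟨c, rfl⟩
    refine ⟨fun j => c (Fin.cast hlen.symm j), ?_⟩
    congr 1
    funext i
    simp only [Matrix.mulVec, dotProduct, Finset.sum_apply, Pi.smul_apply, smul_eq_mul]
    refine Fintype.sum_equiv (finCongr hlen.symm) _ _ fun j => ?_
    simp [vec_ofFn, mul_comm]
  · rintro ⟨c, rfl⟩
    refine ⟨fun j => c (Fin.cast hlen j), ?_⟩
    congr 1
    funext i
    simp only [Matrix.mulVec, dotProduct, Finset.sum_apply, Pi.smul_apply, smul_eq_mul]
    refine Fintype.sum_equiv (finCongr hlen.symm) _ _ fun j => ?_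
    simp [vec_ofFn, mul_comm]

theorem exists_semilinearRep {k : ℕ} {S : Set (Fin k → ℕ)} (h : IsSemilinearSet S) :
    ∃ R : SemilinearRep, SemilinearRep.set k R = S := by
  obtain ⟨T, hT, rfl⟩ := isSemilinearSet_iff.1 h
  choose! rep hrep using fun t ht => exists_linearRep (hT t ht)
  refine ⟨T.toList.map rep, ?_⟩
  ext x
  simp only [SemilinearRep.set, List.mem_map, Finset.mem_toList, Set.mem_ofPred_eq,
    Set.mem_sUnion, Finset.mem_coe]
  constructor
  · rintro ⟨_, ⟨t, ht, rfl⟩, hx⟩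
    exact ⟨t, ht, hrep t ht ▸ hx⟩
  · rintro ⟨t, ht, hx⟩
    exact ⟨rep t, ⟨t, ht, rfl⟩, (hrep t ht).symm ▸ hx⟩

theorem encode_le_of_mem {α : Type*} [Encodable α] {l : List α} {a : α} (h : a ∈ l) :
    Encodable.encode a ≤ Encodable.encode l := by
  induction l with
  | nil => simp at h
  | cons b l ih =>
    rw [Encodable.encode_list_cons]
    rcases List.mem_cons.1 h with rfl | h
    · exact (Nat.left_le_pair _ _).trans (Nat.le_succ _)
    · exact (ih h).trans ((Nat.right_le_pair _ _).trans (Nat.le_succ _))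

theorem length_le_encode {α : Type*} [Encodable α] (l : List α) :
    l.length ≤ Encodable.encode l := by
  induction l with
  | nil => simp
  | cons b l ih =>
    rw [Encodable.encode_list_cons, List.length_cons]
    exact Nat.succ_le_succ (ih.trans (Nat.right_le_pair _ _))

theorem vec_le_encode (k : ℕ) (l : List ℕ) (i : Fin k) : vec k l i ≤ Encodable.encode l := by
  unfold vec
  by_cases h : (i : ℕ) < l.length
  · rw [List.getD_eq_getElem _ _ h]
    exact encode_le_of_mem (List.getElem_mem h)
  · rw [List.getD_eq_default _ _ (by omega)]
    exact Nat.zero_le _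

/-- A level at which the semilinear sets whose representation has code at most `N` are
invariant. -/
def repLevel (N : ℕ) : ℕ := step^[N] (N + 1)

theorem repLevel_mono : Monotone repLevel := by
  intro M N h
  exact ((step_mono.iterate M) (by omega)).trans (iterate_step_le h)

theorem invariant_linearRep (k : ℕ) (L : LinearRep) :
    Invariant (repLevel (Encodable.encode L)) (LinearRep.set k L) := by
  set N := Encodable.encode L with hN
  have h1 : Encodable.encode L.1 ≤ N := Nat.left_le_pair _ _
  have h2 : Encodable.encode L.2 ≤ N := Nat.right_le_pair _ _
  rintro a b hab ⟨c, hc⟩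
  have hab' : PresEquiv (step^[L.2.length] (N + 1)) a b :=
    hab.mono (iterate_step_le ((length_le_encode _).trans h2))
  obtain ⟨c', hc'⟩ := hab'.forth_tuple _ c
  refine ⟨c', ?_⟩
  funext i
  have key : ∀ (x : Fin k → ℕ) (d : Fin L.2.length → ℕ),
      x i = (vec k L.1 + ∑ j, d j • vec k (L.2.get j)) i ↔
      ∑ s, (Sum.elim (fun i' => if i' = i then (1 : ℤ) else 0)
        (fun j => -(vec k (L.2.get j) i : ℤ)) s) * ((Sum.elim x d s : ℕ) : ℤ) =
        (vec k L.1 i : ℤ) := by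
    intro x d
    simp only [Pi.add_apply, Finset.sum_apply, Pi.smul_apply, smul_eq_mul, Fintype.sum_sum_type,
      Sum.elim_inl, Sum.elim_inr, ite_mul, one_mul, zero_mul, Finset.sum_ite_eq',
      Finset.mem_univ, if_true, neg_mul, Finset.sum_neg_distrib]
    zify
    simp only [mul_comm]
    constructor <;> intro h <;> linarith
  rw [key]
  rw [← hc'.eq_iff, ← key, hc]
  · rintro (i' | j)
    · simp only [Sum.elim_inl]
      split_ifs
      · rw [abs_one]
        push_cast
        linarith [(Nat.cast_nonneg N : (0 : ℤ) ≤ N)]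
      · rw [abs_zero]
        positivity
    · simp only [Sum.elim_inr, abs_neg, Nat.abs_cast]
      have := (vec_le_encode k (L.2.get j) i).trans ((encode_le_of_mem (List.get_mem _ _)).trans h2)
      exact_mod_cast this.trans (Nat.le_succ N)
  · rw [Nat.abs_cast]
    exact_mod_cast ((vec_le_encode k L.1 i).trans h1).trans (Nat.le_succ N)

theorem invariant_semilinearRep (k : ℕ) (R : SemilinearRep) :
    Invariant (repLevel (Encodable.encode R)) (SemilinearRep.set k R) := by
  rintro a b hab ⟨L, hL, ha⟩
  exact ⟨L, hL, (invariant_linearRep k L).mono (repLevel_mono (encode_le_of_mem hL)) a b hab ha⟩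

/-! ### Computability of numerical functions and bounded searches -/

section Computability

variable {α : Type*} [Primcodable α]

theorem computable_decode_getD {β : Type*} [Primcodable β] (d : β) :
    Computable fun n : ℕ => ((Encodable.decode n : Option β)).getD d :=
  Computable.option_getD Computable.decode (Computable.const d)

theorem computable_sum_range {f : α → ℕ → ℕ} {N : α → ℕ} (hf : Computable₂ f)
    (hN : Computable N) : Computable fun a => ∑ c ∈ Finset.range (N a), f a c := by
  have h : Computable₂ fun (a : α) (p : ℕ × ℕ) => p.2 + f a p.1 :=
    (Primrec.nat_add.to_comp.comp (Computable.snd.comp Computable.snd)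
      (hf.comp Computable.fst (Computable.fst.comp Computable.snd))).to₂
  refine (Computable.nat_rec hN (Computable.const 0) h).of_eq fun a => ?_
  induction N a with
  | zero => rfl
  | succ n ih => rw [Finset.sum_range_succ, ← ih]

theorem computable_forall_lt {p : α → ℕ → Bool} {N : α → ℕ} (hp : Computable₂ p)
    (hN : Computable N) : Computable fun a => decide (∀ c < N a, p a c = true) := by
  have h : Computable₂ fun (a : α) (q : ℕ × Bool) => q.2 && p a q.1 :=
    (Primrec.and.to_comp.comp (Computable.snd.comp Computable.snd)
      (hp.comp Computable.fst (Computable.fst.comp Computable.snd))).to₂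
  refine (Computable.nat_rec hN (Computable.const true) h).of_eq fun a => ?_
  induction N a with
  | zero => simp
  | succ n ih =>
    rw [Bool.eq_iff_iff] at ih ⊢
    simp only [Bool.and_eq_true, decide_eq_true_eq] at ih ⊢
    rw [ih]
    simp only [Nat.lt_succ_iff_lt_or_eq, or_imp, forall_and, forall_eq]

theorem computable_exists_lt {p : α → ℕ → Bool} {N : α → ℕ} (hp : Computable₂ p)
    (hN : Computable N) : Computable fun a => decide (∃ c < N a, p a c = true) := by
  have h := computable_forall_lt (p := fun a c => !p a c)
    (Primrec.not.to_comp.comp hp : Computable _) hN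
  refine (Primrec.not.to_comp.comp h).of_eq fun a => ?_
  rw [Bool.eq_iff_iff]
  simp

theorem primrec_factorial : Primrec Nat.factorial := by
  have h : Primrec₂ fun (n a : ℕ) => (n + 1) * a :=
    Primrec.nat_mul.comp₂ (Primrec.succ.comp Primrec.fst).to₂ Primrec.snd.to₂
  refine (Primrec.nat_rec₁ 1 h).of_eq fun n => ?_
  induction n with
  | zero => rfl
  | succ n ih => rw [Nat.factorial_succ, ← ih]

theorem primrec_step : Primrec step := by
  have hf := primrec_factorial
  refine (Primrec.nat_add.comp (Primrec.nat_add.comp (Primrec.nat_mul.comp hf hf)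
    (Primrec.nat_mul.comp (Primrec.nat_mul.comp (Primrec.const 2) Primrec.id) hf))
    (Primrec.const 2)).of_eq fun n => ?_
  simp [step, sq]

theorem primrec_iterate_step : Primrec₂ fun n M => step^[n] M :=
  Primrec.nat_iterate Primrec.fst Primrec.snd (primrec_step.comp Primrec.snd).to₂

theorem primrec_repLevel : Primrec repLevel :=
  primrec_iterate_step.comp Primrec.id Primrec.succ

theorem primrec_repBound : Primrec₂ repBound := by
  have h : Primrec₂ fun (p : ℕ × ℕ) (q : ℕ × ℕ) => q.2 + step^[p.1] p.2 * (1 + p.1 * q.2) :=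
    Primrec.nat_add.comp (Primrec.snd.comp Primrec.snd)
      (Primrec.nat_mul.comp (primrec_iterate_step.comp (Primrec.fst.comp Primrec.fst)
        (Primrec.snd.comp Primrec.fst))
        (Primrec.nat_add.comp (Primrec.const 1)
          (Primrec.nat_mul.comp (Primrec.fst.comp Primrec.fst) (Primrec.snd.comp Primrec.snd))))
  exact Primrec.nat_rec' Primrec.fst (Primrec.const 0) h

/-- A bound for the codes of the lists of length at most `k` whose entries have codes at most
`B`. -/
def listCode (B k : ℕ) : ℕ := Nat.rec 0 (fun _ c => Nat.succ (Nat.pair B c)) k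

theorem primrec_listCode : Primrec₂ listCode := by
  have h : Primrec₂ fun (p : ℕ × ℕ) (q : ℕ × ℕ) => Nat.succ (Nat.pair p.1 q.2) :=
    Primrec.succ.comp (Primrec₂.natPair.comp (Primrec.fst.comp Primrec.fst)
      (Primrec.snd.comp Primrec.snd))
  exact Primrec.nat_rec' Primrec.snd (Primrec.const 0) h

theorem pair_le_pair {a b c d : ℕ} (h₁ : a ≤ c) (h₂ : b ≤ d) : Nat.pair a b ≤ Nat.pair c d := by
  rcases h₁.eq_or_lt with rfl | h₁
  · rcases h₂.eq_or_lt with rfl | h₂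
    · exact le_rfl
    · exact (Nat.pair_lt_pair_right _ h₂).le
  · refine (Nat.pair_lt_pair_left _ h₁).le.trans ?_
    rcases h₂.eq_or_lt with rfl | h₂
    · exact le_rfl
    · exact (Nat.pair_lt_pair_right _ h₂).le

theorem encode_le_listCode {β : Type*} [Encodable β] {B k : ℕ} (l : List β) (hk : l.length ≤ k)
    (hB : ∀ b ∈ l, Encodable.encode b ≤ B) : Encodable.encode l ≤ listCode B k := by
  induction l generalizing k with
  | nil => simp
  | cons b l ih =>
    obtain ⟨k, rfl⟩ : ∃ k', k = k' + 1 := ⟨k - 1, by simp at hk; omega⟩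
    rw [Encodable.encode_list_cons]
    exact Nat.succ_le_succ (pair_le_pair (hB b (by simp))
      (ih (by simpa using hk) fun c hc => hB c (by simp [hc])))

end Computability

/-! ### Tame groups: effective invariance of power equations -/

section Tame

variable {K : Type*} [Group K] {n : ℕ}

/-- `g` is represented by a word of length at most `s`. -/
def InBall (a : Fin n → K) (s : ℕ) (g : K) : Prop :=
  ∃ w : Word n, w.length ≤ s ∧ evalWord a w = g

/-- The product `g₀ ^ x₀ * g₁ ^ x₁ * ⋯`. -/
def powProd {m : ℕ} (g : Fin m → K) (x : Fin m → ℕ) : K :=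
  (List.ofFn fun i => g i ^ x i).prod

/-- The bound `β` controls the equations `g₀ ^ x₀ * ⋯ * g_{m-1} ^ x_{m-1} = 1` over a group:
if `m ≤ s` and the `gᵢ` are given by words of length at most `s`, then the set of solutions is
invariant at level `β s`. -/
def Tame (a : Fin n → K) (β : ℕ → ℕ) : Prop :=
  ∀ (s m : ℕ) (g : Fin m → K), m ≤ s → (∀ i, InBall a s (g i)) →
    Invariant (β s) {x | powProd g x = 1}

/-- The product of the powers `g ^ e` over the pairs in the list, where the exponent is a variable
or (for `none`) equal to `1`. -/
def listProd {ι : Type} (l : List (K × Option ι)) (x : ι → ℕ) : K :=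
  (l.map fun p => p.1 ^ (p.2.elim 1 x)).prod

@[simp] theorem listProd_nil {ι : Type} (x : ι → ℕ) : listProd ([] : List (K × Option ι)) x = 1 :=
  rfl

@[simp] theorem listProd_cons {ι : Type} (p : K × Option ι) (l : List (K × Option ι))
    (x : ι → ℕ) : listProd (p :: l) x = p.1 ^ (p.2.elim 1 x) * listProd l x := by
  simp [listProd]

theorem Tame.listProd_eq_one_iff {a : Fin n → K} {β : ℕ → ℕ} (h : Tame a β) {ι : Type} [Fintype ι]
    {s : ℕ} (l : List (K × Option ι)) (hl : l.length ≤ s) (hb : ∀ p ∈ l, InBall a s p.1)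
    {x y : ι → ℕ} (hxy : PresEquiv (β s * (1 + s)) x y) :
    listProd l x = 1 ↔ listProd l y = 1 := by
  have key : ∀ z : ι → ℕ, listProd l z =
      powProd (fun i => (l.get i).1) (fun i => (l.get i).2.elim 1 z) := by
    intro z
    unfold listProd powProd
    conv_lhs => rw [← List.ofFn_get l, List.map_ofFn]
    rfl
  rw [key, key]
  refine (h s _ _ hl fun i => hb _ (List.get_mem _ _)).mem_iff ?_
  refine PresEquiv.elim_one (fun i => (l.get i).2) (hxy.mono ?_)
  simp only [Fintype.card_fin]
  gcongr

/-- In a knapsack-semilinear group, the solution sets of power equations are invariant at a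
computable level, since there are only finitely many such equations of a given size. -/
theorem IsKnapsackSemilinearWith.exists_tame {a : Fin n → K} (h : IsKnapsackSemilinearWith a) :
    ∃ β : ℕ → ℕ, Computable β ∧ Tame a β := by
  obtain ⟨f, hf, hsol⟩ := h
  let W : ℕ → ℕ := fun s => listCode n s
  let C : ℕ → ℕ := fun s => Nat.pair 0 (listCode (Nat.pair (W s) 0) s) + 1
  let F : ℕ → ℕ := fun c =>
    repLevel (Encodable.encode (f ((Encodable.decode c : Option (Expr n)).getD ([], []))))
  have hF : Computable F :=
    primrec_repLevel.to_comp.comp (Computable.encode.comp (hf.comp (computable_decode_getD _)))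
  have hW : Primrec W := primrec_listCode.comp (Primrec.const n) Primrec.id
  have hC : Primrec C := Primrec.succ.comp (Primrec₂.natPair.comp (Primrec.const 0)
    (primrec_listCode.comp (Primrec₂.natPair.comp hW (Primrec.const 0)) Primrec.id))
  refine ⟨fun s => ∑ c ∈ Finset.range (C s), F c,
    computable_sum_range (hF.comp Computable.snd).to₂ hC.to_comp, ?_⟩
  intro s m g hm hg x y hxy hx
  choose w hw hwg using hg
  let E : Expr n := ([], List.ofFn fun i => (w i, []))
  have hd : depth E = m := by simp [E, depth]
  have hcode : Encodable.encode E < C s := by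
    refine Nat.lt_succ_of_le (pair_le_pair Encodable.encode_list_nil.le
      (encode_le_listCode _ (hd.trans_le hm) ?_))
    intro p hp
    obtain ⟨i, rfl⟩ := List.mem_ofFn.1 hp
    refine pair_le_pair (encode_le_listCode _ (hw i) fun j _ => ?_)
      (Encodable.encode_list_nil (α := Fin n)).le
    exact j.2.le
  have hFE : F (Encodable.encode E) = repLevel (Encodable.encode (f E)) := by
    simp only [F, Encodable.encodek, Option.getD_some]
  have hinv : Invariant (∑ c ∈ Finset.range (C s), F c) (Sol a E) := by
    rw [hsol E]
    refine (invariant_semilinearRep _ (f E)).mono ?_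
    rw [← hFE]
    exact Finset.single_le_sum (f := F) (fun _ _ => Nat.zero_le _) (Finset.mem_range.2 hcode)
  have key : ∀ z : Fin m → ℕ, powProd g z = 1 ↔ z ∘ Fin.cast hd ∈ Sol a E := by
    intro z
    rw [mem_Sol_iff, List.ofFn_congr hd]
    simp [E, powProd, evalWord, ← hwg]
  exact (key y).2 (hinv _ _ (hxy.comp_injective _ (Fin.cast_injective hd)) ((key x).1 hx))

end Tame

/-! ### From tameness back to computable semilinear representations -/

section Search

variable {n : ℕ}

/-- The word `subst E (vec _ l)`, computed from the list `l` of exponents. -/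
def substList (E : Expr n) (l : List ℕ) : Word n :=
  E.1 ++ (List.range E.2.length).flatMap fun i =>
    ((List.range (l.getD i 0)).flatMap fun _ => (E.2.getD i ([], [])).1) ++
      (E.2.getD i ([], [])).2

theorem substList_eq (E : Expr n) (l : List ℕ) : substList E l = subst E (vec (depth E) l) := by
  unfold substList subst
  congr 1
  rw [List.flatMap_def]
  congr 1
  refine List.ext_getElem (by simp) fun i h₁ h₂ => ?_
  have hi : i < E.2.length := by simpa using h₁
  have hr : ∀ (k : ℕ) (w : Word n), (List.range k).flatMap (fun _ => w) =
      (List.replicate k w).flatten := by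
    intro k w
    rw [List.flatMap_def, List.map_const', List.length_range]
  simp [vec, hi, hr]

theorem primrec_substList : Primrec₂ (substList (n := n)) := by
  have hpair : Primrec fun q : (Expr n × List ℕ) × ℕ => q.1.1.2.getD q.2 ([], []) :=
    (Primrec.list_getD _).comp (Primrec.snd.comp (Primrec.fst.comp Primrec.fst)) Primrec.snd
  have hexp : Primrec fun q : (Expr n × List ℕ) × ℕ => List.range (q.1.2.getD q.2 0) :=
    Primrec.list_range.comp ((Primrec.list_getD 0).comp
      (Primrec.snd.comp Primrec.fst) Primrec.snd)
  have hpow : Primrec fun q : (Expr n × List ℕ) × ℕ =>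
      (List.range (q.1.2.getD q.2 0)).flatMap fun _ => (q.1.1.2.getD q.2 ([], [])).1 :=
    Primrec.list_flatMap hexp ((Primrec.fst.comp hpair).comp Primrec.fst).to₂
  have hblock : Primrec₂ fun (p : Expr n × List ℕ) (i : ℕ) =>
      ((List.range (p.2.getD i 0)).flatMap fun _ => (p.1.2.getD i ([], [])).1) ++
        (p.1.2.getD i ([], [])).2 :=
    Primrec.list_append.comp hpow (Primrec.snd.comp hpair)
  exact Primrec.list_append.comp (Primrec.fst.comp Primrec.fst)
    (Primrec.list_flatMap (Primrec.list_range.comp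
      (Primrec.list_length.comp (Primrec.snd.comp Primrec.fst))) hblock)

/-- The data `(L, k, l)` of a membership question `vec k l ∈ LinearRep.set k L`. -/
abbrev LinQuery : Type := LinearRep × ℕ × List ℕ

/-- Whether `vec k l` is obtained from `L` with the list of coefficients `c`. -/
def checkCoeffs (q : LinQuery) (c : List ℕ) : Bool :=
  decide (∀ i < q.2.1, decide (q.2.2.getD i 0 = q.1.1.getD i 0 +
    ∑ j ∈ Finset.range q.1.2.length, c.getD j 0 * (q.1.2.getD j []).getD i 0) = true)

theorem computable_checkCoeffs : Computable₂ checkCoeffs := by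
  have hsum : Computable fun p : (LinQuery × List ℕ) × ℕ =>
      ∑ j ∈ Finset.range p.1.1.1.2.length,
        p.1.2.getD j 0 * (p.1.1.1.2.getD j []).getD p.2 0 := by
    refine computable_sum_range (f := fun (p : (LinQuery × List ℕ) × ℕ) j =>
      p.1.2.getD j 0 * (p.1.1.1.2.getD j []).getD p.2 0) (Primrec.to_comp ?_) (Primrec.to_comp ?_)
    · exact Primrec.nat_mul.comp
        ((Primrec.list_getD 0).comp (Primrec.snd.comp (Primrec.fst.comp Primrec.fst)) Primrec.snd)
        ((Primrec.list_getD 0).comp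
          ((Primrec.list_getD []).comp
            (Primrec.snd.comp (Primrec.fst.comp (Primrec.fst.comp (Primrec.fst.comp Primrec.fst))))
            Primrec.snd)
          (Primrec.snd.comp Primrec.fst))
    · exact Primrec.list_length.comp
        (Primrec.snd.comp (Primrec.fst.comp (Primrec.fst.comp Primrec.fst)))
  have hl : Primrec fun p : (LinQuery × List ℕ) × ℕ => p.1.1.2.2.getD p.2 0 :=
    (Primrec.list_getD 0).comp
      (Primrec.snd.comp (Primrec.snd.comp (Primrec.fst.comp Primrec.fst))) Primrec.snd
  have hv : Primrec fun p : (LinQuery × List ℕ) × ℕ => p.1.1.1.1.getD p.2 0 :=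
    (Primrec.list_getD 0).comp
      (Primrec.fst.comp (Primrec.fst.comp (Primrec.fst.comp Primrec.fst))) Primrec.snd
  have heq : Computable₂ fun x y : ℕ => decide (x = y) :=
    (primrecRel_iff_primrec_decide.1 Primrec.eq).to_comp
  exact computable_forall_lt (α := LinQuery × List ℕ)
    (p := fun p i => decide (p.1.2.2.getD i 0 = p.1.1.1.getD i 0 +
      ∑ j ∈ Finset.range p.1.1.2.length, p.2.getD j 0 * (p.1.1.2.getD j []).getD i 0))
    (heq.comp hl.to_comp (Primrec.nat_add.to_comp.comp hv.to_comp hsum))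
    (Primrec.fst.comp (Primrec.snd.comp Primrec.fst)).to_comp

theorem checkCoeffs_iff (L : LinearRep) (k : ℕ) (l c : List ℕ) :
    checkCoeffs (L, k, l) c = true ↔
      vec k l = vec k L.1 + ∑ j : Fin L.2.length, vec L.2.length c j • vec k (L.2.get j) := by
  simp only [checkCoeffs, decide_eq_true_eq, funext_iff, Pi.add_apply, Finset.sum_apply,
    Pi.smul_apply, smul_eq_mul, vec, Fin.forall_iff]
  refine forall₂_congr fun i hi => ?_
  rw [Finset.sum_range]
  simp

/-- Membership in a linear set, by a bounded search for the coefficients. -/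
def memLinear (q : LinQuery) : Bool :=
  decide (∃ c < listCode (Encodable.encode q.2.2) q.1.2.length + 1,
    checkCoeffs q ((Encodable.decode c : Option (List ℕ)).getD []) = true)

theorem computable_memLinear : Computable memLinear := by
  refine computable_exists_lt (α := LinQuery)
    (p := fun q c => checkCoeffs q ((Encodable.decode c : Option (List ℕ)).getD [])) ?_ ?_
  · exact computable_checkCoeffs.comp Computable.fst
      ((computable_decode_getD _).comp Computable.snd)
  · exact (Primrec.succ.comp (primrec_listCode.comp
      (Primrec.encode.comp (Primrec.snd.comp Primrec.snd))
      (Primrec.list_length.comp (Primrec.snd.comp Primrec.fst)))).to_comp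

theorem memLinear_iff (L : LinearRep) (k : ℕ) (l : List ℕ) :
    memLinear (L, k, l) = true ↔ vec k l ∈ LinearRep.set k L := by
  simp only [memLinear, decide_eq_true_eq, checkCoeffs_iff, LinearRep.set, Set.mem_ofPred_eq]
  constructor
  · rintro ⟨c, -, h⟩
    exact ⟨_, h⟩
  · rintro ⟨c, hc⟩
    classical
    -- Coefficients of zero vectors may be set to `0`; the others are bounded by the vector.
    let c' : Fin L.2.length → ℕ := fun j => if vec k (L.2.get j) = 0 then 0 else c j
    have hsm : ∀ j, c' j • vec k (L.2.get j) = c j • vec k (L.2.get j) := by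
      intro j
      by_cases h : vec k (L.2.get j) = 0
      · rw [h, smul_zero, smul_zero]
      · simp only [c', if_neg h]
    have hle : ∀ j, c' j ≤ Encodable.encode l := by
      intro j
      by_cases h : vec k (L.2.get j) = 0
      · simp only [c', if_pos h, Nat.zero_le]
      · obtain ⟨i, hi⟩ := Function.ne_iff.1 h
        simp only [Pi.zero_apply] at hi
        have h1 : c j * vec k (L.2.get j) i ≤ vec k l i := by
          rw [hc]
          simp only [Pi.add_apply, Finset.sum_apply, Pi.smul_apply, smul_eq_mul]
          exact le_add_left (Finset.single_le_sum (f := fun j => c j * vec k (L.2.get j) i)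
            (fun _ _ => Nat.zero_le _) (Finset.mem_univ j))
        simp only [c', if_neg h]
        exact (Nat.le_mul_of_pos_right _ (Nat.pos_of_ne_zero hi)).trans
          (h1.trans (vec_le_encode k l i))
    refine ⟨Encodable.encode (List.ofFn c'), Nat.lt_succ_of_le (encode_le_listCode _ (by simp) ?_),
      ?_⟩
    · intro b hb
      obtain ⟨j, rfl⟩ := List.mem_ofFn.1 hb
      exact hle j
    · simp only [Encodable.encodek, Option.getD_some, vec_ofFn, hsm]
      exact hc

/-- Membership of `vec k l` in the semilinear set with representation `R`. -/
def memSemilinear (q : SemilinearRep × ℕ × List ℕ) : Bool :=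
  decide (∃ j < q.1.length, memLinear (q.1.getD j ([], []), q.2) = true)

theorem computable_memSemilinear : Computable memSemilinear := by
  refine computable_exists_lt (α := SemilinearRep × ℕ × List ℕ)
    (p := fun q j => memLinear (q.1.getD j ([], []), q.2)) ?_ ?_
  · exact computable_memLinear.comp (Computable.pair ((Primrec.list_getD _).to_comp.comp
      (Computable.fst.comp Computable.fst) Computable.snd) (Computable.snd.comp Computable.fst))
  · exact Computable.list_length.comp Computable.fst

theorem memSemilinear_iff (R : SemilinearRep) (k : ℕ) (l : List ℕ) :
    memSemilinear (R, k, l) = true ↔ vec k l ∈ SemilinearRep.set k R := by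
  simp only [memSemilinear, decide_eq_true_eq, memLinear_iff, SemilinearRep.set, Set.mem_ofPred_eq]
  constructor
  · rintro ⟨j, hj, h⟩
    rw [List.getD_eq_getElem _ _ hj] at h
    exact ⟨_, List.getElem_mem hj, h⟩
  · rintro ⟨L, hL, h⟩
    obtain ⟨j, hj, rfl⟩ := List.getElem_of_mem hL
    exact ⟨j, hj, by rwa [List.getD_eq_getElem _ _ hj]⟩

/-- A search for a witness of a decidable relation succeeds computably if it always succeeds. -/
theorem exists_computable_choice {α γ : Type*} [Primcodable α] [Primcodable γ] (d : γ)
    {p : α → γ → Bool} (hp : Computable₂ p) (h : ∀ a, ∃ c, p a c = true) :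
    ∃ f : α → γ, Computable f ∧ ∀ a, p a (f a) = true := by
  classical
  let q : α → ℕ → Bool := fun a c => p a ((Encodable.decode c : Option γ).getD d)
  have hq : Computable₂ q :=
    hp.comp Computable.fst ((computable_decode_getD d).comp Computable.snd)
  have hex : ∀ a, ∃ c, q a c = true := fun a => by
    obtain ⟨c, hc⟩ := h a
    exact ⟨Encodable.encode c, by simpa [q] using hc⟩
  have hfind : Computable fun a => Nat.find (hex a) := by
    refine (Partrec.rfind hq.partrec₂).of_eq_tot fun a => ?_
    refine Nat.mem_rfind.2 ⟨?_, fun {m} hm => ?_⟩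
    · exact Part.mem_some_iff.2 (Nat.find_spec (hex a)).symm
    · exact Part.mem_some_iff.2 (Bool.eq_false_iff.2 (Nat.find_min (hex a) hm)).symm
  exact ⟨fun a => (Encodable.decode (Nat.find (hex a)) : Option γ).getD d,
    (computable_decode_getD d).comp hfind, fun a => Nat.find_spec (hex a)⟩

variable {K : Type*} [Group K] {a : Fin n → K} {β : ℕ → ℕ}

/-- A level at which the solution set of the expression of code `N` is invariant, for a group
with bound `β`. -/
def solLevel (β : ℕ → ℕ) (N : ℕ) : ℕ := β (1 + N * 2) * (1 + (1 + N * 2))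

theorem Tame.invariant_sol (h : Tame a β) (E : Expr n) :
    Invariant (solLevel β (Encodable.encode E)) (Sol a E) := by
  set N := Encodable.encode E with hN
  let l : List (K × Option (Fin (depth E))) := (evalWord a E.1, none) ::
    (List.ofFn fun i : Fin (depth E) =>
      [(evalWord a (E.2.get i).1, some i), (evalWord a (E.2.get i).2, none)]).flatten
  have key : ∀ x, x ∈ Sol a E ↔ listProd l x = 1 := by
    intro x
    rw [mem_Sol_iff]
    simp [l, listProd, List.map_flatten, List.map_ofFn, List.prod_flatten, Function.comp_def]
  have h1 : Encodable.encode E.1 ≤ N := Nat.left_le_pair _ _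
  have h2 : Encodable.encode E.2 ≤ N := Nat.right_le_pair _ _
  have hball : ∀ w : Word n, Encodable.encode w ≤ N → InBall a (1 + N * 2) (evalWord a w) :=
    fun w hw => ⟨w, by have := length_le_encode w; omega, rfl⟩
  intro x y hxy hx
  rw [key] at hx ⊢
  refine (h.listProd_eq_one_iff (s := 1 + N * 2) l ?_ ?_ hxy).1 hx
  · have h3 : l.length = 1 + depth E * 2 := by
      simp [l, List.length_flatten, List.map_ofFn, Function.comp_def, add_comm]
    rw [h3]
    have : depth E ≤ N := (length_le_encode _).trans h2
    omega
  · intro p hp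
    rcases List.mem_cons.1 hp with rfl | hp
    · exact hball _ h1
    · obtain ⟨_, hl', hp⟩ := List.mem_flatten.1 hp
      obtain ⟨i, rfl⟩ := List.mem_ofFn.1 hl'
      have h4 : Encodable.encode (E.2.get i) ≤ N := (encode_le_of_mem (List.get_mem _ _)).trans h2
      rcases List.mem_cons.1 hp with rfl | hp
      · exact hball _ ((Nat.left_le_pair _ _).trans h4)
      · rw [List.mem_singleton.1 hp]
        exact hball _ ((Nat.right_le_pair _ _).trans h4)

/-- A tame group with computable bound and decidable word problem is knapsack-semilinear: a
representation is found by search, as its correctness can be checked on finitely many vectors. -/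
theorem Tame.isKnapsackSemilinearWith (h : Tame a β) (hβ : Computable β) {D : Word n → Bool}
    (hD : Computable D) (hDa : ∀ w, D w = true ↔ evalWord a w = 1) :
    IsKnapsackSemilinearWith a := by
  let B : Expr n → SemilinearRep → ℕ := fun E R => repBound E.2.length
    (solLevel β (Encodable.encode E) + repLevel (Encodable.encode R))
  let test : Expr n × SemilinearRep → ℕ → Bool := fun q c =>
    (memSemilinear (q.2, q.1.2.length, (Encodable.decode c : Option (List ℕ)).getD [])) ==
      D (substList q.1 ((Encodable.decode c : Option (List ℕ)).getD []))
  have htest : Computable₂ test := by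
    have hdec : Computable fun q : (Expr n × SemilinearRep) × ℕ =>
        (Encodable.decode q.2 : Option (List ℕ)).getD [] :=
      (computable_decode_getD _).comp Computable.snd
    exact (Primrec.beq (α := Bool)).to_comp.comp
      (computable_memSemilinear.comp (Computable.pair (Computable.snd.comp Computable.fst)
        (Computable.pair (Computable.list_length.comp
          (Computable.snd.comp (Computable.fst.comp Computable.fst))) hdec)))
      (hD.comp (primrec_substList.to_comp.comp (Computable.fst.comp Computable.fst) hdec))
  have hlevel : Computable (solLevel β) := by
    have h1 : Primrec fun N : ℕ => 1 + N * 2 :=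
      Primrec.nat_add.comp (Primrec.const 1) (Primrec.nat_mul.comp Primrec.id (Primrec.const 2))
    exact Primrec.nat_mul.to_comp.comp (hβ.comp h1.to_comp)
      (Primrec.nat_add.comp (Primrec.const 1) h1).to_comp
  have hB : Computable fun q : Expr n × SemilinearRep => B q.1 q.2 :=
    primrec_repBound.to_comp.comp
      (Computable.list_length.comp (Computable.snd.comp Computable.fst))
      (Primrec.nat_add.to_comp.comp (hlevel.comp (Computable.encode.comp Computable.fst))
        (primrec_repLevel.to_comp.comp (Computable.encode.comp Computable.snd)))
  let check : Expr n → SemilinearRep → Bool := fun E R =>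
    decide (∀ c < listCode (B E R) E.2.length + 1, test (E, R) c = true)
  have hcheck : Computable₂ check :=
    computable_forall_lt (α := Expr n × SemilinearRep) htest
      (Computable.succ.comp (primrec_listCode.to_comp.comp hB
        (Computable.list_length.comp (Computable.snd.comp Computable.fst))))
  have htest_iff : ∀ E R c, test (E, R) c = true ↔
      (vec (depth E) ((Encodable.decode c : Option (List ℕ)).getD []) ∈
        SemilinearRep.set (depth E) R ↔
      vec (depth E) ((Encodable.decode c : Option (List ℕ)).getD []) ∈ Sol a E) := by
    intro E R c
    simp only [test, beq_iff_eq]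
    rw [Bool.eq_iff_iff, memSemilinear_iff, hDa, substList_eq]
    rfl
  obtain ⟨f, hf, hfc⟩ := exists_computable_choice [] hcheck fun E => by
    obtain ⟨R, hR⟩ := exists_semilinearRep (h.invariant_sol E).isSemilinearSet
    refine ⟨R, ?_⟩
    simp only [check, decide_eq_true_eq, htest_iff, hR, implies_true]
  refine ⟨f, hf, fun E => ?_⟩
  have hc := hfc E
  simp only [check, decide_eq_true_eq, htest_iff] at hc
  refine ((h.invariant_sol E).mono (Nat.le_add_right _ _)).eq_of_bounded
    ((invariant_semilinearRep _ (f E)).mono (Nat.le_add_left _ _)) fun x hx => ?_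
  have := hc (Encodable.encode (List.ofFn x)) (Nat.lt_succ_of_le
    (encode_le_listCode _ (by simp) fun b hb => ?_))
  · simpa only [Encodable.encodek, Option.getD_some, vec_ofFn] using this.symm
  · obtain ⟨i, rfl⟩ := List.mem_ofFn.1 hb
    exact hx i

end Search

/-! ### Comparing products of sequences with few nontrivial terms -/

theorem PresEquiv.lt_iff {ι : Type} [Fintype ι] {M : ℕ} (hM : 1 ≤ M) {a b : ι → ℕ}
    (h : PresEquiv M a b) (i j : ι) : a i < a j ↔ b i < b j := by
  classical
  have key : ∀ x : ι → ℕ, x i < x j ↔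
      ∑ k, ((if k = i then 1 else 0) - (if k = j then 1 else 0) : ℤ) * (x k : ℤ) ≤ -1 := by
    intro x
    simp only [sub_mul, ite_mul, one_mul, zero_mul, Finset.sum_sub_distrib, Finset.sum_ite_eq',
      Finset.mem_univ, if_true]
    omega
  have hM' : (1 : ℤ) ≤ M := by exact_mod_cast hM
  rw [key, key]
  refine h.le_iff _ _ (fun k => ?_) (by simpa using hM')
  split_ifs <;> simp <;> omega

/-- Forgetting the middle one of the last two coordinates. -/
theorem PresEquiv.drop_middle {ι : Type} [Fintype ι] {M : ℕ} {a b : ι → ℕ} {y t y' t' : ℕ}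
    (h : PresEquiv M (snoc (snoc a y) t) (snoc (snoc b y') t')) :
    PresEquiv M (snoc a t) (snoc b t') := by
  have := h.comp_injective (Option.map some) (Option.map_injective (Option.some_injective ι))
  convert this using 1 <;> (funext o; cases o <;> rfl)

theorem prod_range_of_last {G : Type*} [Group G] {φ : ℕ → G} {t y : ℕ} (hty : t < y)
    (h : ∀ s, t < s → s < y → φ s = 1) :
    ((List.range y).map φ).prod = ((List.range t).map φ).prod * φ t := by
  induction y with
  | zero => omega
  | succ y ih =>
    rw [List.range_succ, List.map_append, List.prod_append]
    rcases Nat.lt_succ_iff_lt_or_eq.1 hty with hlt | rfl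
    · rw [ih hlt fun s h1 h2 => h s h1 (by omega)]
      simp [h y hlt (Nat.lt_succ_self y)]
    · simp

theorem prod_range_eq_one {G : Type*} [Group G] {φ : ℕ → G} {y : ℕ} (h : ∀ s < y, φ s = 1) :
    ((List.range y).map φ).prod = 1 := by
  refine List.prod_eq_one fun g hg => ?_
  obtain ⟨s, hs, rfl⟩ := List.mem_map.1 hg
  exact h s (List.mem_range.1 hs)

open Classical in
/-- If two sequences of group elements agree at equivalent times and have few nontrivial terms,
then their products up to equivalent times agree: the last nontrivial terms are matched by
back-and-forth. -/
theorem prod_range_eq_of_presEquiv {G : Type*} [Group G] {ι : Type} [Fintype ι] {M : ℕ}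
    (hM : 1 ≤ M) {u u' : ι → ℕ} {φ φ' : ℕ → G}
    (hφ : ∀ t t', PresEquiv M (snoc u t) (snoc u' t') → φ t = φ' t') (n : ℕ) {y y' : ℕ}
    (hn : ((Finset.range y).filter fun t => φ t ≠ 1).card ≤ n)
    (h : PresEquiv (step^[2 * n + 1] M) (snoc u y) (snoc u' y')) :
    ((List.range y).map φ).prod = ((List.range y').map φ').prod := by
  induction n generalizing y y' with
  | zero =>
    have hnil : ∀ t < y, φ t = 1 := by
      intro t ht
      by_contra hne
      have : t ∈ (Finset.range y).filter fun t => φ t ≠ 1 := by simp [ht, hne]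
      rw [Finset.card_eq_zero.1 (Nat.le_zero.1 hn)] at this
      simp at this
    rw [prod_range_eq_one hnil, prod_range_eq_one fun t' ht' => ?_]
    obtain ⟨t, ht⟩ := PresEquiv.forth (M := M) h.symm t'
    have hlt : t < y := (ht.lt_iff hM none (some none)).1 ht'
    rw [← hφ t t' ht.symm.drop_middle, hnil t hlt]
  | succ n ih =>
    by_cases hex : ((Finset.range y).filter fun t => φ t ≠ 1).Nonempty
    · have hmem := Finset.max'_mem _ hex
      have hmax := Finset.le_max' ((Finset.range y).filter fun t => φ t ≠ 1)
      set t := ((Finset.range y).filter fun t => φ t ≠ 1).max' hex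
      simp only [Finset.mem_filter, Finset.mem_range] at hmem hmax
      rw [show 2 * (n + 1) + 1 = (2 * n + 1 + 1) + 1 by ring, Function.iterate_succ_apply'] at h
      obtain ⟨t', ht'⟩ := h.forth t
      have hMle : M ≤ step^[2 * n + 1 + 1] M := le_iterate_step _ _
      have hlt' : t' < y' := (ht'.lt_iff (hM.trans hMle) none (some none)).1 hmem.1
      have hgap : ∀ s, t < s → s < y → φ s = 1 := by
        intro s h1 h2
        by_contra hne
        exact absurd (hmax s ⟨h2, hne⟩) (by omega)
      have hgap' : ∀ s, t' < s → s < y' → φ' s = 1 := by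
        intro s' h1 h2
        rw [Function.iterate_succ_apply'] at ht'
        obtain ⟨s, hs⟩ := ht'.symm.forth s'
        have hs' := hs.mono (le_iterate_step _ _ : M ≤ _)
        have h3 : t < s := (hs'.lt_iff hM (some none) none).1 h1
        have h4 : s < y := (hs'.lt_iff hM none (some (some none))).1 h2
        have h5 := hs'.drop_middle.drop_middle
        rw [← hφ s s' h5.symm, hgap s h3 h4]
      rw [prod_range_of_last hmem.1 hgap, prod_range_of_last hlt' hgap',
        ih ?_ (ht'.drop_middle.mono (iterate_step_le (Nat.le_succ _))),
        hφ t t' (ht'.drop_middle.mono hMle)]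
      refine Nat.le_of_lt_succ (lt_of_lt_of_le (Finset.card_lt_card ?_) hn)
      refine Finset.ssubset_iff_subset_ne.2 ⟨?_, fun heq => ?_⟩
      · intro s hs
        simp only [Finset.mem_filter, Finset.mem_range] at hs ⊢
        exact ⟨hs.1.trans hmem.1, hs.2⟩
      · have : t ∈ (Finset.range t).filter fun t => φ t ≠ 1 := by
          rw [heq]
          simpa using hmem
        simp at this
    · refine ih ?_ (h.mono (iterate_step_le (by omega)))
      rw [Finset.not_nonempty_iff_eq_empty.1 hex]
      simp

/-! ### Balls in groups -/

section Ball

variable {K : Type*} [Group K] {n : ℕ} {a : Fin n → K} {s t : ℕ} {g h : K}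

theorem InBall.one : InBall a s 1 := ⟨[], by simp, rfl⟩

theorem InBall.mul (hg : InBall a s g) (hh : InBall a t h) : InBall a (s + t) (g * h) := by
  obtain ⟨w, hw, rfl⟩ := hg
  obtain ⟨w', hw', rfl⟩ := hh
  exact ⟨w ++ w', by simp only [List.length_append]; omega, evalWord_append _ _ _⟩

theorem InBall.mono (hg : InBall a s g) (hst : s ≤ t) : InBall a t g := by
  obtain ⟨w, hw, rfl⟩ := hg
  exact ⟨w, hw.trans hst, rfl⟩

theorem InBall.pow (hg : InBall a s g) (k : ℕ) : InBall a (s * k) (g ^ k) := by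
  induction k with
  | zero => simpa using InBall.one
  | succ k ih =>
    rw [pow_succ]
    exact ih.mul hg

theorem InBall.inv (ha : ∀ i, ∃ j, a j = (a i)⁻¹) (hg : InBall a s g) : InBall a s g⁻¹ := by
  choose j hj using ha
  obtain ⟨w, hw, rfl⟩ := hg
  refine ⟨(w.map j).reverse, by simpa using hw, ?_⟩
  simp [evalWord, List.prod_inv_reverse, Function.comp_def, hj, List.map_reverse]

theorem InBall.letter (i : Fin n) : InBall a 1 (a i) := ⟨[i], by simp, by simp [evalWord]⟩

open Classical in
theorem InBall.prod_range {φ : ℕ → K} (hφ : ∀ t, InBall a s (φ t)) {k : ℕ} (y : ℕ)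
    (hk : ((Finset.range y).filter fun t => φ t ≠ 1).card ≤ k) :
    InBall a (k * s) ((List.range y).map φ).prod := by
  induction y generalizing k with
  | zero => exact InBall.one
  | succ y ih =>
    rw [List.range_succ, List.map_append, List.prod_append, List.map_singleton, List.prod_singleton]
    rw [Finset.range_add_one, Finset.filter_insert] at hk
    split_ifs at hk with hy
    · rw [Finset.card_insert_of_notMem (by simp)] at hk
      obtain ⟨k, rfl⟩ : ∃ k', k = k' + 1 := ⟨k - 1, by omega⟩
      rw [add_mul, one_mul]
      exact (ih (by omega)).mul (hφ y)
    · rw [not_not.1 hy, mul_one]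
      exact ih hk

/-- In a tame group, the torsion elements of a ball have a common exponent. -/
theorem Tame.pow_factorial_eq_one {β : ℕ → ℕ} (hβ : Tame a β) (hs : 1 ≤ s) (hg : InBall a s g)
    (ht : 0 < t) (hgt : g ^ t = 1) : g ^ (β s).factorial = 1 := by
  set M := β s
  have hinv := hβ s 1 (fun _ => g) hs fun _ => hg
  have hpow : ∀ x : Fin 1 → ℕ, powProd (fun _ => g) x = g ^ x 0 := by
    intro x
    simp [powProd]
  have hequiv : PresEquiv M (fun _ : Fin 1 => t * (M + 1))
      (fun _ : Fin 1 => t * (M + 1) + M.factorial) := by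
    constructor
    · intro l c hl hc
      simp only [Fin.sum_univ_one]
      have hl := hl 0
      have hx : (M : ℤ) + 1 ≤ ((t * (M + 1) : ℕ) : ℤ) := by
        exact_mod_cast Nat.le_mul_of_pos_left _ ht
      have hf : (0 : ℤ) ≤ (M.factorial : ℤ) := by positivity
      have hM0 : (0 : ℤ) ≤ M := by positivity
      rw [abs_le] at hc
      rcases lt_trichotomy (l 0) 0 with h0 | h0 | h0
      · refine iff_of_true ?_ ?_ <;> push_cast at * <;> nlinarith
      · simp [h0]
      · refine iff_of_false ?_ ?_ <;> push_cast at * <;> nlinarith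
    · intro m h1 h2 _
      have : M.factorial ≡ 0 [MOD m] := (Nat.modEq_zero_iff_dvd).2 (Nat.dvd_factorial h1 h2)
      simpa using (Nat.ModEq.add_left (t * (M + 1)) this).symm
  have h1 := hinv _ _ hequiv (by simp [hpow, pow_mul, hgt])
  simpa [hpow, pow_add, pow_mul, hgt] using h1

end Ball

/-- Equivalence of the quotients by `Q`. -/
theorem PresEquiv.div {ι : Type} [Fintype ι] {M Q : ℕ} (hQ : 0 < Q) {a b : ι → ℕ}
    (h : PresEquiv (M * Q * (1 + Fintype.card ι) + Q) a b) :
    (∀ i, a i % Q = b i % Q) ∧ PresEquiv M (fun i => a i / Q) (fun i => b i / Q) := by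
  have hmod : ∀ i, a i % Q = b i % Q := fun i => h.modEq Q hQ (Nat.le_add_left _ _) i
  have hQ' : (0 : ℤ) < Q := by exact_mod_cast hQ
  have hle : M * Q ≤ M * Q * (1 + Fintype.card ι) + Q :=
    (Nat.le_mul_of_pos_right _ (by omega)).trans (Nat.le_add_right _ _)
  refine ⟨hmod, ?_, ?_⟩
  · intro l c hl hc
    have key : ∀ x : ι → ℕ, (∀ i, x i % Q = a i % Q) →
        (∑ i, l i * ((x i / Q : ℕ) : ℤ) ≤ c ↔
          ∑ i, l i * (x i : ℤ) ≤ c * Q + ∑ i, l i * ((a i % Q : ℕ) : ℤ)) := by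
      intro x hx
      have h1 : ∑ i, l i * (x i : ℤ) =
          (∑ i, l i * ((x i / Q : ℕ) : ℤ)) * Q + ∑ i, l i * ((a i % Q : ℕ) : ℤ) := by
        rw [Finset.sum_mul, ← Finset.sum_add_distrib]
        refine Finset.sum_congr rfl fun i _ => ?_
        have h2 : ((x i : ℕ) : ℤ) = Q * ((x i / Q : ℕ) : ℤ) + ((a i % Q : ℕ) : ℤ) := by
          rw [← hx i]
          exact_mod_cast (Nat.div_add_mod (x i) Q).symm
        rw [h2]
        ring
      rw [h1, add_le_add_iff_right, mul_le_mul_iff_of_pos_right hQ']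
    rw [key a fun _ => rfl, key b fun i => (hmod i).symm]
    refine h.le_iff _ _ (fun i => (hl i).trans ?_) ?_
    · have : M ≤ M * Q * (1 + Fintype.card ι) + Q := (Nat.le_mul_of_pos_right _ hQ).trans hle
      exact_mod_cast this
    · have h3 : |∑ i, l i * ((a i % Q : ℕ) : ℤ)| ≤ Fintype.card ι * (M * Q) := by
        refine (Finset.abs_sum_le_sum_abs _ _).trans ?_
        refine (Finset.sum_le_card_nsmul _ _ ((M : ℤ) * Q) fun i _ => ?_).trans (by simp)
        rw [abs_mul, Nat.abs_cast]
        exact mul_le_mul (hl i) (by exact_mod_cast (Nat.mod_lt _ hQ).le) (by positivity)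
          (by positivity)
      have h4 : |c * (Q : ℤ)| ≤ M * Q := by
        rw [abs_mul, Nat.abs_cast]
        exact mul_le_mul_of_nonneg_right hc hQ'.le
      have h5 : ((M * Q * (1 + Fintype.card ι) + Q : ℕ) : ℤ) =
          M * Q + Fintype.card ι * (M * Q) + Q := by
        push_cast
        ring
      refine (abs_add_le _ _).trans ?_
      rw [h5]
      linarith
  · intro m h1 h2 i
    have hm : a i ≡ b i [MOD m * Q] :=
      h.modEq (m * Q) (Nat.mul_pos h1 hQ) ((Nat.mul_le_mul_right _ h2).trans hle) i
    rw [← Nat.div_add_mod (a i) Q, ← Nat.div_add_mod (b i) Q, hmod i, mul_comm m Q] at hm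
    exact Nat.ModEq.mul_left_cancel' hQ.ne' (Nat.ModEq.add_right_cancel' _ hm)

/-! ### Elements of the wreath product of bounded size -/

section Wreath

variable {G : Type u} {H : Type v} [Group G] [Group H]

theorem left_mul_apply (x y : RegularWreathProduct G H) (p : H) :
    (x * y).left p = x.left p * y.left (x.right⁻¹ * p) := rfl

theorem right_pow (w : RegularWreathProduct G H) (y : ℕ) : (w ^ y).right = w.right ^ y :=
  map_pow RegularWreathProduct.rightHom w y

theorem left_pow_apply (w : RegularWreathProduct G H) (y : ℕ) (b : H) :
    (w ^ y).left b = ((List.range y).map fun t => w.left ((w.right ^ t)⁻¹ * b)).prod := by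
  induction y with
  | zero => rfl
  | succ y ih => rw [pow_succ, left_mul_apply, ih, right_pow, List.range_succ]; simp

/-- The left component of a product of powers, read along the list. -/
theorem left_listProd_cons {ι : Type} (p : RegularWreathProduct G H × Option ι)
    (l : List (RegularWreathProduct G H × Option ι)) (x : ι → ℕ) (b : H) :
    (listProd (p :: l) x).left b = (p.1 ^ (p.2.elim 1 x)).left b *
      (listProd l x).left ((p.1.right⁻¹) ^ (p.2.elim 1 x) * b) := by
  rw [listProd_cons, left_mul_apply, right_pow, inv_pow]

theorem right_listProd {ι : Type} (l : List (RegularWreathProduct G H × Option ι)) (x : ι → ℕ) :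
    (listProd l x).right = listProd (l.map fun p => (p.1.right, p.2)) x := by
  induction l with
  | nil => rfl
  | cons p l ih => rw [listProd_cons, RegularWreathProduct.mul_right, ih, right_pow]; simp

/-- The element `w` of the wreath product has size at most `s`: its right component and the
elements of its support lie in the ball of radius `s` of `H`, its values lie in the ball of radius
`s` of `G`, and its support has at most `s` elements. -/
structure IsSmall {nG nH : ℕ} (aG : Fin nG → G) (aH : Fin nH → H) (s : ℕ)
    (w : RegularWreathProduct G H) : Prop where
  right : InBall aH s w.right
  finite : {p | w.left p ≠ 1}.Finite
  ncard_le : {p | w.left p ≠ 1}.ncard ≤ s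
  mem_ball : ∀ p, w.left p ≠ 1 → InBall aH s p
  value : ∀ p, InBall aG s (w.left p)

open Classical in
/-- The letters of `G`, placed at position `1`, and the letters of `H`, as letters of the wreath
product. -/
noncomputable def wreathLetter {nG nH : ℕ} (aG : Fin nG → G) (aH : Fin nH → H) (i : Fin (nG + nH)) :
    RegularWreathProduct G H :=
  Fin.addCases (fun i => ⟨Pi.mulSingle 1 (aG i), 1⟩) (fun j => ⟨1, aH j⟩) i

variable {nG nH : ℕ} {aG : Fin nG → G} {aH : Fin nH → H} {s : ℕ}

theorem IsSmall.mono {w : RegularWreathProduct G H} {t : ℕ} (h : IsSmall aG aH s w)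
    (hst : s ≤ t) : IsSmall aG aH t w :=
  ⟨h.right.mono hst, h.finite, h.ncard_le.trans hst, fun p hp => (h.mem_ball p hp).mono hst,
    fun p => (h.value p).mono hst⟩

open Classical in
theorem isSmall_of_inBall {w : RegularWreathProduct G H}
    (h : InBall (wreathLetter aG aH) s w) : IsSmall aG aH s w := by
  obtain ⟨l, hl, rfl⟩ := h
  refine IsSmall.mono ?_ hl
  clear hl
  induction l with
  | nil =>
    refine ⟨InBall.one, ?_, ?_, fun p hp => absurd rfl hp, fun p => InBall.one⟩ <;>
      simp [evalWord]
  | cons i l ih =>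
    have hcons : evalWord (wreathLetter aG aH) (i :: l) =
        wreathLetter aG aH i * evalWord (wreathLetter aG aH) l := by simp [evalWord]
    rw [hcons, List.length_cons]
    set y := evalWord (wreathLetter aG aH) l
    cases i using Fin.addCases with
    | left i =>
      have hw : wreathLetter aG aH (Fin.castAdd nH i) = ⟨Pi.mulSingle 1 (aG i), 1⟩ := by
        simp [wreathLetter]
      rw [hw]
      have hleft : ∀ p, ((⟨Pi.mulSingle 1 (aG i), 1⟩ : RegularWreathProduct G H) * y).left p =
          (Pi.mulSingle 1 (aG i) : H → G) p * y.left p := by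
        intro p
        rw [left_mul_apply]
        simp
      have hne : ∀ p, p ≠ 1 → ((⟨Pi.mulSingle 1 (aG i), 1⟩ : RegularWreathProduct G H) * y).left p =
          y.left p := by
        intro p hp
        rw [hleft, Pi.mulSingle_eq_of_ne hp, one_mul]
      have hsub : {p | ((⟨Pi.mulSingle 1 (aG i), 1⟩ : RegularWreathProduct G H) * y).left p ≠ 1} ⊆
          insert 1 {p | y.left p ≠ 1} := by
        intro p hp
        by_cases h1 : p = 1
        · exact Or.inl h1
        · rw [Set.mem_ofPred_eq, hne p h1] at hp
          exact Or.inr hp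
      refine ⟨?_, (ih.finite.insert 1).subset hsub, ?_, ?_, ?_⟩
      · simpa using ih.right.mono (Nat.le_succ _)
      · exact (Set.ncard_le_ncard hsub (ih.finite.insert 1)).trans
          ((Set.ncard_insert_le _ _).trans (Nat.succ_le_succ ih.ncard_le))
      · intro p hp
        rcases hsub hp with rfl | h1
        · exact InBall.one
        · exact (ih.mem_ball p h1).mono (Nat.le_succ _)
      · intro p
        by_cases h1 : p = 1
        · rw [hleft, h1, Pi.mulSingle_eq_same, add_comm]
          exact (InBall.letter i).mul (ih.value 1)
        · rw [hne p h1]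
          exact (ih.value p).mono (Nat.le_succ _)
    | right j =>
      have hw : wreathLetter aG aH (Fin.natAdd nG j) = ⟨1, aH j⟩ := by simp [wreathLetter]
      rw [hw]
      have hleft : ∀ p, ((⟨1, aH j⟩ : RegularWreathProduct G H) * y).left p =
          y.left ((aH j)⁻¹ * p) := by
        intro p
        rw [left_mul_apply]
        simp
      have hset : {p | ((⟨1, aH j⟩ : RegularWreathProduct G H) * y).left p ≠ 1} =
          (fun p => aH j * p) '' {p | y.left p ≠ 1} := by
        ext p
        simp only [hleft, Set.mem_ofPred_eq, Set.mem_image]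
        constructor
        · exact fun hp => ⟨_, hp, by group⟩
        · rintro ⟨q, hq, rfl⟩
          simpa using hq
      refine ⟨?_, ?_, ?_, ?_, ?_⟩
      · rw [add_comm]
        exact (InBall.letter j).mul ih.right
      · rw [hset]
        exact ih.finite.image _
      · rw [hset, Set.ncard_image_of_injective _ (mul_right_injective _)]
        exact ih.ncard_le.trans (Nat.le_succ _)
      · intro p hp
        rw [hleft] at hp
        have := (InBall.letter j).mul (ih.mem_ball _ hp)
        rwa [mul_inv_cancel_left, add_comm] at this
      · intro p
        rw [hleft]
        exact (ih.value _).mono (Nat.le_succ _)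

/-! ### Values of products of powers in the wreath product -/

/-- Renaming the exponents so as to make room for a new variable. -/
def liftList {K : Type*} {ι : Type} (l : List (K × Option ι)) : List (K × Option (Option ι)) :=
  l.map fun p => (p.1, p.2.map some)

@[simp] theorem liftList_cons {K : Type*} {ι : Type} (p : K × Option ι)
    (l : List (K × Option ι)) : liftList (p :: l) = (p.1, p.2.map some) :: liftList l := rfl

@[simp] theorem listProd_liftList {K : Type*} [Group K] {ι : Type} (l : List (K × Option ι))
    (x : ι → ℕ) (y : ℕ) : listProd (liftList l) (snoc x y) = listProd l x := by
  induction l with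
  | nil => rfl
  | cons p l ih =>
    rw [liftList_cons, listProd_cons, listProd_cons, ih]
    rcases p with ⟨g, _ | i⟩ <;> rfl

theorem liftList_length {K : Type*} {ι : Type} (l : List (K × Option ι)) :
    (liftList l).length = l.length := by simp [liftList]

theorem forall_mem_liftList {K : Type*} {ι : Type} {l : List (K × Option ι)} {P : K → Prop}
    (h : ∀ p ∈ l, P p.1) : ∀ p ∈ liftList l, P p.1 := by
  intro p hp
  obtain ⟨q, hq, rfl⟩ := List.mem_map.1 hp
  exact h q hq

/-- The value of a small element at a position given by a product of powers depends only on the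
equivalence class of the exponents. -/
theorem IsSmall.left_listProd_eq {βH : ℕ → ℕ} (hβH : Tame aH βH) (haH : ∀ i, ∃ j, aH j = (aH i)⁻¹)
    {S : ℕ} {w : RegularWreathProduct G H} (hw : IsSmall aG aH S w) {ι : Type} [Fintype ι]
    {x y : ι → ℕ} (hxy : PresEquiv (βH S * (1 + S)) x y) (lb : List (H × Option ι))
    (hlb : ∀ q ∈ lb, InBall aH S q.1) (hlen : lb.length + 1 ≤ S) :
    w.left (listProd lb x) = w.left (listProd lb y) := by
  have key : ∀ {x y : ι → ℕ}, PresEquiv (βH S * (1 + S)) x y → w.left (listProd lb x) ≠ 1 →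
      w.left (listProd lb x) = w.left (listProd lb y) := by
    intro x y hxy hne
    have hp := hw.mem_ball _ hne
    set p := listProd lb x with hpx
    have h1 := (hβH.listProd_eq_one_iff ((p⁻¹, none) :: lb) (by simpa using hlen) (by
      intro q hq
      rcases List.mem_cons.1 hq with rfl | hq
      · exact hp.inv haH
      · exact hlb q hq) hxy).1 (by simp [← hpx])
    have h2 : p = listProd lb y := by
      simpa [inv_mul_eq_one] using h1
    rw [h2]
  by_cases h : w.left (listProd lb x) = 1
  · by_cases h' : w.left (listProd lb y) = 1
    · rw [h, h']
    · exact (key hxy.symm h').symm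
  · exact key hxy h

/-- A power for which the values of the wreath product can be described uniformly: the exponent is
`1`, or the right component is trivial or of infinite order. -/
def IsRegularPower {ι : Type} (p : RegularWreathProduct G H × Option ι) : Prop :=
  p.2 = none ∨ p.1.right = 1 ∨ ∀ t, 0 < t → p.1.right ^ t ≠ 1

open Classical in
/-- Along an orbit of infinite order, a small element takes few nontrivial values. -/
theorem IsSmall.card_filter_le {w : RegularWreathProduct G H} (hw : IsSmall aG aH s w)
    (hinf : ∀ t, 0 < t → w.right ^ t ≠ 1) (b : H) (y : ℕ) :
    ((Finset.range y).filter fun t => w.left ((w.right ^ t)⁻¹ * b) ≠ 1).card ≤ s := by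
  refine le_trans ?_ hw.ncard_le
  rw [Set.ncard_eq_toFinset_card _ hw.finite]
  refine Finset.card_le_card_of_injOn (fun t => (w.right ^ t)⁻¹ * b) (fun t ht => ?_) ?_
  · have := (Finset.mem_filter.1 ht).2
    simpa using this
  · intro t _ t' _ heq
    have hinj : Function.Injective fun t : ℕ => w.right ^ t :=
      injective_pow_iff_not_isOfFinOrder.2 fun h => by
        obtain ⟨t, ht, h1⟩ := isOfFinOrder_iff_pow_eq_one.1 h
        exact hinf t ht h1
    exact hinj (by simpa using heq)

/-- For equivalent exponents, the values of a product of regular powers at corresponding positions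
are given by one and the same product of powers in `G`. -/
theorem exists_common_values {βH : ℕ → ℕ} (hβH : Tame aH βH)
    (haH : ∀ i, ∃ j, aH j = (aH i)⁻¹) {S M : ℕ} (hsS : s ≤ S) (hM : βH S * (1 + S) + 1 ≤ M)
    {ι : Type} [Fintype ι] {x y : ι → ℕ} (hxy : PresEquiv (step^[2 * s + 2] M) x y)
    (l : List (RegularWreathProduct G H × Option ι)) (hl : ∀ p ∈ l, IsSmall aG aH s p.1)
    (hreg : ∀ p ∈ l, IsRegularPower p) (lb : List (H × Option ι))
    (hlb : ∀ q ∈ lb, InBall aH S q.1) (hlen : lb.length + l.length + 2 ≤ S) :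
    ∃ c : List (G × Option ι), c.length = l.length ∧ (∀ q ∈ c, InBall aG (s * s + s) q.1) ∧
      (listProd l x).left (listProd lb x) = listProd c x ∧
      (listProd l y).left (listProd lb y) = listProd c y := by
  classical
  induction l generalizing lb with
  | nil => exact ⟨[], rfl, by simp, rfl, rfl⟩
  | cons p l ih =>
    rcases p with ⟨w, e⟩
    have hw := hl _ List.mem_cons_self
    have hwS := hw.mono hsS
    have hxyM : PresEquiv M x y := hxy.mono (le_iterate_step _ _)
    have hM1 : 1 ≤ M := by omega
    obtain ⟨c, hc, hcb, hcx, hcy⟩ := ih (fun p hp => hl p (List.mem_cons_of_mem _ hp))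
      (fun p hp => hreg p (List.mem_cons_of_mem _ hp)) ((w.right⁻¹, e) :: lb) (by
        intro q hq
        rcases List.mem_cons.1 hq with rfl | hq
        · exact hwS.right.inv haH
        · exact hlb q hq) (by simp only [List.length_cons] at hlen ⊢; omega)
    rw [listProd_cons] at hcx hcy
    suffices h : ∃ q : G × Option ι, InBall aG (s * s + s) q.1 ∧
        (w ^ (e.elim 1 x)).left (listProd lb x) = q.1 ^ (q.2.elim 1 x) ∧
        (w ^ (e.elim 1 y)).left (listProd lb y) = q.1 ^ (q.2.elim 1 y) by
      obtain ⟨q, hq, hqx, hqy⟩ := h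
      refine ⟨q :: c, by simp [hc], ?_, ?_, ?_⟩
      · intro q' hq'
        rcases List.mem_cons.1 hq' with rfl | hq'
        · exact hq
        · exact hcb q' hq'
      · rw [left_listProd_cons, hqx, hcx, listProd_cons]
      · rw [left_listProd_cons, hqy, hcy, listProd_cons]
    have hbase : w.left (listProd lb x) = w.left (listProd lb y) :=
      hwS.left_listProd_eq hβH haH (hxyM.mono (by omega)) lb hlb
        (by simp only [List.length_cons] at hlen; omega)
    have hball : InBall aG (s * s + s) (w.left (listProd lb x)) :=
      (hw.value _).mono (Nat.le_add_left _ _)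
    rcases e with _ | i
    · exact ⟨(w.left (listProd lb x), none), hball, by simp, by simp [hbase]⟩
    rcases hreg _ List.mem_cons_self with hnone | hone | hinf
    · simp at hnone
    · -- The position does not move, so the value is a power with the same exponent.
      have hpow : ∀ (k : ℕ) (b : H), (w ^ k).left b = w.left b ^ k := by
        intro k b
        have hone' : w.right = 1 := hone
        rw [left_pow_apply]
        simp [hone']
      exact ⟨(w.left (listProd lb x), some i), hball, hpow _ _, by rw [hbase]; exact hpow _ _⟩
    · -- The position is visited boundedly often, so the value is a bounded product.
      have hinf' : ∀ t, 0 < t → w.right ^ t ≠ 1 := hinf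
      let orb : (ι → ℕ) → ℕ → G := fun z t => w.left ((w.right ^ t)⁻¹ * listProd lb z)
      have horb : ∀ z t, orb z t =
          w.left (listProd ((w.right⁻¹, some none) :: liftList lb) (snoc z t)) := by
        intro z t
        simp [orb]
      have hφ : ∀ t t', PresEquiv M (snoc x t) (snoc y t') → orb x t = orb y t' := by
        intro t t' h
        rw [horb, horb]
        refine hwS.left_listProd_eq hβH haH (h.mono (by omega)) _ (fun q hq => ?_) ?_
        · rcases List.mem_cons.1 hq with rfl | hq
          · exact hwS.right.inv haH
          · exact forall_mem_liftList hlb q hq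
        · simp only [List.length_cons, liftList_length] at hlen ⊢
          omega
      have hcard := hw.card_filter_le hinf' (listProd lb x) (x i)
      obtain ⟨t', ht'⟩ := PresEquiv.forth (M := step^[2 * s + 1] M)
        (by rwa [← Function.iterate_succ_apply' step]) (x i)
      have hlev : 1 ≤ step^[2 * s + 1] M := hM1.trans (le_iterate_step _ _)
      have ht'i : t' = y i := by
        have h1 := ht'.lt_iff hlev none (some i)
        have h2 := ht'.lt_iff hlev (some i) none
        simp only [snoc_none, snoc_some] at h1 h2
        omega
      rw [ht'i] at ht'
      have heq := prod_range_eq_of_presEquiv hM1 hφ s hcard ht'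
      refine ⟨(((List.range (x i)).map (orb x)).prod, none), ?_, ?_, ?_⟩
      · exact (InBall.prod_range (fun t => hw.value _) _ hcard).mono (Nat.le_add_right _ _)
      · rw [Option.elim_some, left_pow_apply]
        simp [orb]
      · rw [Option.elim_some, left_pow_apply, heq]
        simp [orb]

/-- A position at which a product of powers has a nontrivial value is itself a product of powers,
with one further exponent. -/
theorem exists_position {ι : Type} {x : ι → ℕ} {S : ℕ}
    (l : List (RegularWreathProduct G H × Option ι)) (hl : ∀ p ∈ l, IsSmall aG aH S p.1) (a : H)
    (ha : (listProd l x).left a ≠ 1) :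
    ∃ (lb : List (H × Option (Option ι))) (t : ℕ), lb.length ≤ l.length + 1 ∧
      (∀ q ∈ lb, InBall aH S q.1) ∧ a = listProd lb (snoc x t) := by
  induction l generalizing a with
  | nil => exact absurd rfl ha
  | cons p l ih =>
    have hw := hl _ List.mem_cons_self
    rw [left_listProd_cons] at ha
    set k := p.2.elim 1 x with hk
    by_cases h1 : (p.1 ^ k).left a = 1
    · rw [h1, one_mul] at ha
      obtain ⟨lb, t, hlen, hlb, heq⟩ := ih (fun p hp => hl p (List.mem_cons_of_mem _ hp)) _ ha
      refine ⟨(p.1.right, p.2.map some) :: lb, t, by simpa using hlen, ?_, ?_⟩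
      · intro q hq
        rcases List.mem_cons.1 hq with rfl | hq
        · exact hw.right
        · exact hlb q hq
      · rw [listProd_cons, ← heq]
        have : (p.2.map some).elim 1 (snoc x t) = k := by
          rw [hk]
          cases p.2 <;> rfl
        simp [this]
    · obtain ⟨t, ht⟩ : ∃ t, p.1.left ((p.1.right ^ t)⁻¹ * a) ≠ 1 := by
        by_contra hcon
        push Not at hcon
        refine h1 ?_
        rw [left_pow_apply]
        exact prod_range_eq_one fun t _ => hcon t
      refine ⟨[(p.1.right, some none), ((p.1.right ^ t)⁻¹ * a, none)], t, by simp, ?_, ?_⟩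
      · intro q hq
        rcases List.mem_cons.1 hq with rfl | hq
        · exact hw.right
        · rw [List.mem_singleton.1 hq]
          exact hw.mem_ball _ ht
      · simp

/-- Invariance of equations between regular powers in the wreath product. -/
theorem listProd_eq_one_of_presEquiv {βG βH : ℕ → ℕ} (hβG : Tame aG βG) (hβH : Tame aH βH)
    (haH : ∀ i, ∃ j, aH j = (aH i)⁻¹) {S T M : ℕ} (hsS : s ≤ S)
    (hM : βH S * (1 + S) + βG T * (1 + T) + 1 ≤ M) {ι : Type} [Fintype ι] {x y : ι → ℕ}
    (hxy : PresEquiv (step^[2 * s + 3] M) x y)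
    (l : List (RegularWreathProduct G H × Option ι)) (hl : ∀ p ∈ l, IsSmall aG aH s p.1)
    (hreg : ∀ p ∈ l, IsRegularPower p) (hlen : 2 * l.length + 3 ≤ S) (hT : s * s + s ≤ T)
    (hlT : l.length ≤ T) (h : listProd l x = 1) : listProd l y = 1 := by
  refine RegularWreathProduct.ext ?_ ?_
  · funext a
    by_contra hne
    obtain ⟨lb, t', hlb, hball, rfl⟩ := exists_position l (fun p hp => hl p hp) a hne
    obtain ⟨t, ht⟩ := PresEquiv.forth (M := step^[2 * s + 2] M)
      (by rw [← Function.iterate_succ_apply' step]; exact hxy.symm) t'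
    obtain ⟨c, hc, hcb, hcx, hcy⟩ := exists_common_values hβH haH hsS (by omega) ht.symm
      (liftList l) (forall_mem_liftList hl) (by
        intro p hp
        obtain ⟨q, hq, rfl⟩ := List.mem_map.1 hp
        rcases hreg q hq with h0 | h0
        · exact Or.inl (by simp [h0])
        · exact Or.inr h0) lb (fun q hq => (hball q hq).mono hsS)
      (by rw [liftList_length]; omega)
    rw [listProd_liftList] at hcx hcy
    rw [h] at hcx
    have hMT : βG T * (1 + T) ≤ step^[2 * s + 2] M :=
      (by omega : _ ≤ M).trans (le_iterate_step _ _)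
    have := (hβG.listProd_eq_one_iff c (by rw [hc, liftList_length]; exact hlT)
      (fun q hq => (hcb q hq).mono hT) (ht.symm.mono hMT)).1 hcx.symm
    exact hne (hcy.trans this)
  · have hr : (listProd l x).right = 1 := by rw [h]; rfl
    rw [right_listProd] at hr ⊢
    refine (hβH.listProd_eq_one_iff (s := S) _ (by simp; omega) (fun q hq => ?_)
      (hxy.mono ((by omega : _ ≤ M).trans (le_iterate_step _ _)))).1 hr
    obtain ⟨p, hp, rfl⟩ := List.mem_map.1 hq
    exact (hl p hp).right.mono hsS

/-- The exponent that trivializes torsion in the ball of radius `s + 1` of `H`. -/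
def torsionExp (βH : ℕ → ℕ) (s : ℕ) : ℕ := (βH (s + 1)).factorial

/-- The size of the blocks after splitting off remainders modulo the torsion exponent. -/
def blockSize (βH : ℕ → ℕ) (s : ℕ) : ℕ := s * torsionExp βH s

/-- The invariance level of power equations in the wreath product. -/
def wreathLevel (βG βH : ℕ → ℕ) (s : ℕ) : ℕ :=
  let b := blockSize βH s
  let S := b + 4 * s + 3
  let T := b * b + b + 2 * s
  step^[2 * b + 3] (βH S * (1 + S) + βG T * (1 + T) + 1) * torsionExp βH s * (1 + s) +
    torsionExp βH s

/-- Tameness passes to wreath products. Division with remainder by a common torsion exponent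
reduces the claim to regular powers. -/
theorem Tame.wreath {βG βH : ℕ → ℕ} (hβG : Tame aG βG) (hβH : Tame aH βH)
    (haH : ∀ i, ∃ j, aH j = (aH i)⁻¹) :
    Tame (wreathLetter aG aH) (wreathLevel βG βH) := by
  intro s m g hm hg x y hxy hx
  set Q := torsionExp βH s with hQ
  have hQ0 : 0 < Q := Nat.factorial_pos _
  set b := blockSize βH s with hb
  obtain ⟨hmod, hdiv⟩ := PresEquiv.div (Q := Q) (a := x) (b := y) hQ0 (hxy.mono (by
    simp only [Fintype.card_fin, wreathLevel]
    gcongr))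
  let l : List (RegularWreathProduct G H × Option (Fin m)) :=
    (List.ofFn fun i => [(g i ^ Q, some i), (g i ^ (x i % Q), none)]).flatten
  have key : ∀ z : Fin m → ℕ, (∀ i, x i % Q = z i % Q) →
      powProd g z = listProd l fun i => z i / Q := by
    intro z hz
    simp only [l, listProd, powProd, List.map_flatten, List.map_ofFn, List.prod_flatten]
    congr 2
    funext i
    simp [← pow_mul, ← pow_add, hz i, Nat.div_add_mod]
  have hlen : l.length = m * 2 := by
    simp [l, List.length_flatten, List.map_ofFn, Function.comp_def]
  have hmem : ∀ p ∈ l, ∃ i, p = (g i ^ Q, some i) ∨ p = (g i ^ (x i % Q), none) := by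
    intro p hp
    obtain ⟨_, hl', hp⟩ := List.mem_flatten.1 hp
    obtain ⟨i, rfl⟩ := List.mem_ofFn.1 hl'
    exact ⟨i, by simpa using hp⟩
  rw [Set.mem_ofPred_eq, key x fun _ => rfl] at hx
  rw [Set.mem_ofPred_eq, key y hmod]
  refine listProd_eq_one_of_presEquiv (s := b) (S := b + 4 * s + 3) (T := b * b + b + 2 * s)
    hβG hβH haH (by omega) le_rfl hdiv l ?_ ?_ (by omega) (by omega) (by omega) hx
  · intro p hp
    obtain ⟨i, rfl | rfl⟩ := hmem p hp
    · exact isSmall_of_inBall ((hg i).pow Q)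
    · exact isSmall_of_inBall (((hg i).pow _).mono
        (Nat.mul_le_mul_left _ (Nat.mod_lt _ hQ0).le))
  · intro p hp
    obtain ⟨i, rfl | rfl⟩ := hmem p hp
    · refine Or.inr ?_
      by_cases hcase : ∃ t, 0 < t ∧ (g i).right ^ t = 1
      · obtain ⟨t, ht, h1⟩ := hcase
        refine Or.inl ?_
        change (g i ^ Q).right = 1
        rw [right_pow]
        exact hβH.pow_factorial_eq_one (by omega)
          ((isSmall_of_inBall (hg i)).right.mono (Nat.le_succ s)) ht h1
      · refine Or.inr fun t ht h1 => hcase ⟨Q * t, Nat.mul_pos hQ0 ht, ?_⟩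
        change (g i ^ Q).right ^ t = 1 at h1
        rwa [right_pow, ← pow_mul] at h1
    · exact Or.inl rfl

theorem computable_wreathLevel {βG βH : ℕ → ℕ} (hG : Computable βG) (hH : Computable βH) :
    Computable (wreathLevel βG βH) := by
  have add : ∀ {f g : ℕ → ℕ}, Computable f → Computable g → Computable fun n => f n + g n :=
    fun hf hg => Primrec.nat_add.to_comp.comp hf hg
  have mul : ∀ {f g : ℕ → ℕ}, Computable f → Computable g → Computable fun n => f n * g n :=
    fun hf hg => Primrec.nat_mul.to_comp.comp hf hg
  have cst : ∀ c : ℕ, Computable fun _ : ℕ => c := Computable.const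
  have hQ : Computable (torsionExp βH) :=
    primrec_factorial.to_comp.comp (hH.comp Computable.succ)
  have hb : Computable (blockSize βH) := mul Computable.id hQ
  have hS : Computable fun s => blockSize βH s + 4 * s + 3 :=
    add (add hb (mul (cst 4) Computable.id)) (cst 3)
  have hT : Computable fun s => blockSize βH s * blockSize βH s + blockSize βH s + 2 * s :=
    add (add (mul hb hb) hb) (mul (cst 2) Computable.id)
  exact add (mul (mul (primrec_iterate_step.to_comp.comp (add (mul (cst 2) hb) (cst 3))
    (add (add (mul (hH.comp hS) (add (cst 1) hS)) (mul (hG.comp hT) (add (cst 1) hT))) (cst 1)))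
    hQ) (add (cst 1) Computable.id)) hQ

end Wreath

/-! ### Transfer along injective homomorphisms -/

theorem evalWord_comp {K L : Type*} [Group K] [Group L] (φ : K →* L) {n : ℕ} (a : Fin n → K)
    (w : Word n) : evalWord (φ ∘ a) w = φ (evalWord a w) := by
  simp [evalWord, map_list_prod]

theorem isKnapsackSemilinearWith_comp_iff {K L : Type*} [Group K] [Group L] {φ : K →* L}
    (hφ : Function.Injective φ) {n : ℕ} (a : Fin n → K) :
    IsKnapsackSemilinearWith (φ ∘ a) ↔ IsKnapsackSemilinearWith a := by
  have : ∀ E : Expr n, Sol (φ ∘ a) E = Sol a E := by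
    intro E
    ext ν
    simp only [Sol, Set.mem_ofPred_eq, evalWord_comp]
    exact map_eq_one_iff φ hφ
  simp only [IsKnapsackSemilinearWith, this]

open Pointwise in
theorem exists_isSymmGenerating {K : Type*} [Group K] (h : Group.FG K) :
    ∃ (n : ℕ) (a : Fin n → K), IsSymmGenerating a := by
  classical
  obtain ⟨S, hS⟩ := Group.fg_def.1 h
  let T : Finset K := S ∪ S⁻¹
  refine ⟨T.card, fun i => (T.equivFin.symm i : K), fun i => ?_, fun g => ?_⟩
  · have hi : ((T.equivFin.symm i : K))⁻¹ ∈ T := by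
      have := (T.equivFin.symm i).2
      simp only [T, Finset.mem_union, Finset.mem_inv', inv_inv] at this ⊢
      exact this.symm
    exact ⟨T.equivFin ⟨_, hi⟩, by simp⟩
  · have hg : g ∈ Submonoid.closure ((S : Set K) ∪ (S : Set K)⁻¹) := by
      rw [← Subgroup.closure_toSubmonoid, hS]
      trivial
    obtain ⟨l, hl, rfl⟩ := Submonoid.exists_list_of_mem_closure hg
    refine ⟨l.attach.map fun x => T.equivFin ⟨x.1, ?_⟩, ?_⟩
    · have := hl x.1 x.2
      simpa [T] using this
    · simp [evalWord, Function.comp_def]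

theorem IsSymmGenerating.fg {K : Type*} [Group K] {n : ℕ} {a : Fin n → K}
    (ha : IsSymmGenerating a) : Group.FG K := by
  refine Group.fg_iff.2 ⟨Set.range a, ?_, Set.finite_range a⟩
  refine (Subgroup.eq_top_iff' _).2 fun g => ?_
  obtain ⟨w, rfl⟩ := ha.2 g
  refine Subgroup.list_prod_mem _ fun x hx => ?_
  obtain ⟨i, -, rfl⟩ := List.mem_map.1 hx
  exact Subgroup.subset_closure ⟨i, rfl⟩

/-- Knapsack-semilinearity passes to finitely generated subgroups. -/
theorem IsKnapsackSemilinear.of_injective {K : Type u} {L : Type v} [Group K] [Group L]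
    (h : IsKnapsackSemilinear L) {φ : K →* L} (hφ : Function.Injective φ) (hK : Group.FG K) :
    IsKnapsackSemilinear K := by
  obtain ⟨n, a, ha⟩ := exists_isSymmGenerating hK
  exact ⟨n, a, ha, (isKnapsackSemilinearWith_comp_iff hφ a).1 (h.with_of_group (φ ∘ a))⟩

/-- The word problem is the case of knapsack expressions without variables. -/
theorem IsKnapsackSemilinearWith.exists_wordProblem {K : Type*} [Group K] {n : ℕ} {a : Fin n → K}
    (h : IsKnapsackSemilinearWith a) :
    ∃ D : Word n → Bool, Computable D ∧ ∀ w, D w = true ↔ evalWord a w = 1 := by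
  obtain ⟨f, hf, hsol⟩ := h
  refine ⟨fun w => decide (0 < (f (w, [])).length), ?_, fun w => ?_⟩
  · exact (primrecRel_iff_primrec_decide.1 Primrec.nat_lt).to_comp.comp (Computable.const 0)
      (Computable.list_length.comp (hf.comp (Computable.pair Computable.id (Computable.const []))))
  · have h1 : evalWord a w = 1 ↔ (fun i => i.elim0 : Fin (depth ((w, []) : Expr n)) → ℕ) ∈
        Sol a (w, []) := by
      rw [mem_Sol_iff]
      simp
    rw [h1, hsol, decide_eq_true_eq, List.length_pos_iff_exists_mem]
    constructor
    · rintro ⟨L, hL⟩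
      exact ⟨L, hL, fun _ => 0, funext fun i => i.elim0⟩
    · rintro ⟨L, hL, -⟩
      exact ⟨L, hL⟩

/-! ### The word problem of the wreath product -/

section WordProblem

variable {G : Type u} {H : Type v} [Group G] [Group H] {nG nH : ℕ} {aG : Fin nG → G}
  {aH : Fin nH → H}

/-- The subword of the letters of `G`. -/
def gPart (w : Word (nG + nH)) : Word nG :=
  w.flatMap fun i => Fin.addCases (motive := fun _ => Word nG) (fun i => [i]) (fun _ => []) i

/-- The subword of the letters of `H`. -/
def hPart (w : Word (nG + nH)) : Word nH :=
  w.flatMap fun i => Fin.addCases (motive := fun _ => Word nH) (fun _ => []) (fun j => [j]) i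

theorem primrec_gPart : Primrec (gPart (nG := nG) (nH := nH)) :=
  Primrec.list_flatMap Primrec.id ((Primrec.dom_finite _).comp Primrec.snd).to₂

theorem primrec_hPart : Primrec (hPart (nG := nG) (nH := nH)) :=
  Primrec.list_flatMap Primrec.id ((Primrec.dom_finite _).comp Primrec.snd).to₂

theorem evalWord_cons {K : Type*} [Group K] {n : ℕ} (a : Fin n → K) (i : Fin n) (w : Word n) :
    evalWord a (i :: w) = a i * evalWord a w := by simp [evalWord]

@[simp] theorem evalWord_nil {K : Type*} [Group K] {n : ℕ} (a : Fin n → K) :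
    evalWord a [] = 1 := rfl

@[simp] theorem wreathLetter_castAdd_right (i : Fin nG) :
    (wreathLetter aG aH (Fin.castAdd nH i)).right = 1 := by simp [wreathLetter]

@[simp] theorem wreathLetter_natAdd (j : Fin nH) :
    wreathLetter aG aH (Fin.natAdd nG j) = ⟨1, aH j⟩ := by simp [wreathLetter]

open Classical in
theorem wreathLetter_castAdd (i : Fin nG) :
    wreathLetter aG aH (Fin.castAdd nH i) = ⟨Pi.mulSingle 1 (aG i), 1⟩ := by simp [wreathLetter]

theorem right_evalWord (w : Word (nG + nH)) :
    (evalWord (wreathLetter aG aH) w).right = evalWord aH (hPart w) := by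
  induction w with
  | nil => rfl
  | cons i w ih =>
    have : hPart (i :: w) = hPart [i] ++ hPart w := by simp [hPart]
    rw [evalWord_cons, RegularWreathProduct.mul_right, ih, this, evalWord_append]
    congr 1
    cases i using Fin.addCases <;> simp [hPart, evalWord_cons]

open Classical in
/-- One more letter changes the left component only at the current position. -/
theorem left_evalWord_take_succ (w : Word (nG + nH)) (k : ℕ) (p : H) :
    (evalWord (wreathLetter aG aH) (w.take (k + 1))).left p =
      (evalWord (wreathLetter aG aH) (w.take k)).left p *
        if evalWord aH (hPart (w.take k)) = p then evalWord aG (gPart w[k]?.toList) else 1 := by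
  rw [List.take_add_one, evalWord_append, left_mul_apply, right_evalWord]
  congr 1
  have key : ∀ q : H, (evalWord (wreathLetter aG aH) w[k]?.toList).left q =
      if q = 1 then evalWord aG (gPart w[k]?.toList) else 1 := by
    intro q
    cases w[k]? with
    | none => simp [gPart]
    | some i =>
      simp only [Option.toList_some, evalWord_cons, evalWord_nil, mul_one]
      cases i using Fin.addCases with
      | left i => simp [wreathLetter_castAdd, gPart, evalWord_cons, Pi.mulSingle_apply]
      | right j => simp [gPart]
  rw [key, inv_mul_eq_one]

/-- The product of the letters of `G` placed by the first `k` letters of `w` at the position given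
by the inverse of `v`, where `D` decides the word problem of `H`. -/
def wordAt (D : Word nH → Bool) (w : Word (nG + nH)) (v : Word nH) (k : ℕ) : Word nG :=
  Nat.rec [] (fun k acc => acc ++
    bif D (v ++ hPart (w.take k)) then gPart w[k]?.toList else []) k

theorem evalWord_wordAt {D : Word nH → Bool} (hD : ∀ w, D w = true ↔ evalWord aH w = 1)
    (w : Word (nG + nH)) (v : Word nH) (k : ℕ) :
    evalWord aG (wordAt D w v k) =
      (evalWord (wreathLetter aG aH) (w.take k)).left (evalWord aH v)⁻¹ := by
  induction k with
  | zero => simp [wordAt]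
  | succ k ih =>
    have hsucc : wordAt D w v (k + 1) = wordAt D w v k ++
      bif D (v ++ hPart (w.take k)) then gPart w[k]?.toList else [] := rfl
    rw [left_evalWord_take_succ, hsucc, evalWord_append, ih]
    congr 1
    have hiff : D (v ++ hPart (w.take k)) = true ↔
        evalWord aH (hPart (w.take k)) = (evalWord aH v)⁻¹ := by
      rw [hD, evalWord_append, mul_eq_one_iff_eq_inv, eq_inv_iff_mul_eq_one, eq_inv_iff_mul_eq_one,
        mul_eq_one_comm]
    by_cases h : D (v ++ hPart (w.take k)) = true
    · rw [if_pos (hiff.1 h), h, cond_true]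
    · rw [if_neg (mt hiff.2 h), Bool.eq_false_iff.2 h, cond_false, evalWord_nil]

theorem left_evalWord_eq_one_of_forall_ne (w : Word (nG + nH)) (p : H) (k : ℕ)
    (h : ∀ i < k, evalWord aH (hPart (w.take i)) ≠ p) :
    (evalWord (wreathLetter aG aH) (w.take k)).left p = 1 := by
  induction k with
  | zero => simp
  | succ k ih =>
    rw [left_evalWord_take_succ, ih fun i hi => h i (by omega), if_neg (h k (Nat.lt_succ_self k)),
      mul_one]

theorem computable_wordAt {D : Word nH → Bool} (hD : Computable D) :
    Computable fun p : (Word (nG + nH) × Word nH) × ℕ => wordAt D p.1.1 p.1.2 p.2 := by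
  have hw : Computable fun q : ((Word (nG + nH) × Word nH) × ℕ) × (ℕ × Word nG) => q.1.1.1 :=
    Computable.fst.comp (Computable.fst.comp Computable.fst)
  have hk : Computable fun q : ((Word (nG + nH) × Word nH) × ℕ) × (ℕ × Word nG) => q.2.1 :=
    Computable.fst.comp Computable.snd
  have hv : Computable fun q : ((Word (nG + nH) × Word nH) × ℕ) × (ℕ × Word nG) => q.1.1.2 :=
    Computable.snd.comp (Computable.fst.comp Computable.fst)
  exact Computable.nat_rec Computable.snd (Computable.const [])
    (Computable.list_append.comp (Computable.snd.comp Computable.snd)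
      (Computable.cond (hD.comp (Computable.list_append.comp hv
          (primrec_hPart.to_comp.comp (Primrec.list_take.to_comp.comp hk hw))))
        (primrec_gPart.to_comp.comp (Primrec.optionToList.to_comp.comp
          (Computable.list_getElem?.comp hw hk)))
        (Computable.const []))).to₂

/-- The word problem of the wreath product is decidable: it suffices to compute the values at the
positions visited by the word. -/
theorem exists_wordProblem_wreath (haH : ∀ i, ∃ j, aH j = (aH i)⁻¹) {DG : Word nG → Bool}
    {DH : Word nH → Bool} (hDG : Computable DG) (hDH : Computable DH)
    (hG : ∀ w, DG w = true ↔ evalWord aG w = 1) (hH : ∀ w, DH w = true ↔ evalWord aH w = 1) :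
    ∃ D : Word (nG + nH) → Bool, Computable D ∧
      ∀ w, D w = true ↔ evalWord (wreathLetter aG aH) w = 1 := by
  choose j hj using haH
  let inv : Word nH → Word nH := fun w => (w.map j).reverse
  have hinv : ∀ w, evalWord aH (inv w) = (evalWord aH w)⁻¹ := by
    intro w
    simp [inv, evalWord, List.prod_inv_reverse, Function.comp_def, hj, List.map_reverse]
  have hinvc : Primrec inv := Primrec.list_reverse.comp
    (Primrec.list_map Primrec.id ((Primrec.dom_finite j).comp Primrec.snd).to₂)
  refine ⟨fun w => DH (hPart w) && decide (∀ i < w.length,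
    DG (wordAt DH w (inv (hPart (w.take i))) w.length) = true), ?_, fun w => ?_⟩
  · have hi : Computable fun q : Word (nG + nH) × ℕ => inv (hPart (q.1.take q.2)) :=
      (hinvc.comp (primrec_hPart.comp (Primrec.list_take.comp Primrec.snd Primrec.fst))).to_comp
    have hat : Computable fun q : Word (nG + nH) × ℕ =>
        wordAt DH q.1 (inv (hPart (q.1.take q.2))) q.1.length :=
      (computable_wordAt hDH).comp (g := fun q : Word (nG + nH) × ℕ =>
        ((q.1, inv (hPart (q.1.take q.2))), q.1.length))
        (Computable.pair (Computable.pair Computable.fst hi)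
          (Computable.list_length.comp Computable.fst))
    have hall := computable_forall_lt (p := fun (w : Word (nG + nH)) i =>
      DG (wordAt DH w (inv (hPart (w.take i))) w.length)) (hDG.comp hat).to₂ Computable.list_length
    exact Primrec.and.to_comp.comp (hDH.comp primrec_hPart.to_comp) hall
  · simp only [Bool.and_eq_true, decide_eq_true_eq, hG, hH, evalWord_wordAt hH, hinv, inv_inv,
      List.take_length, ← right_evalWord (aG := aG)]
    constructor
    · rintro ⟨hr, hl⟩
      refine RegularWreathProduct.ext (funext fun p => ?_) hr
      by_cases hp : ∃ i < w.length, evalWord aH (hPart (w.take i)) = p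
      · obtain ⟨i, hi, rfl⟩ := hp
        rw [← right_evalWord (aG := aG)]
        exact hl i hi
      · push Not at hp
        have := left_evalWord_eq_one_of_forall_ne (aG := aG) w p w.length hp
        rwa [List.take_length] at this
    · intro h
      rw [h]
      exact ⟨rfl, fun _ _ => rfl⟩

end WordProblem

/-! ### Generators of the wreath product and its factors -/

section Generators

variable {G : Type u} {H : Type v} [Group G] [Group H] {nG nH : ℕ} {aG : Fin nG → G}
  {aH : Fin nH → H}

open Classical in
/-- The embedding of `G` as the group of elements supported at position `1`. -/
noncomputable def baseHom (G : Type u) (H : Type v) [Group G] [Group H] :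
    G →* restrictedWreathProduct G H where
  toFun g := ⟨⟨Pi.mulSingle 1 g, 1⟩, (Set.finite_singleton (1 : H)).subset fun h hh => by
    by_contra hne
    have h1 : (Pi.mulSingle 1 g : H → G) h = 1 := by
      rw [Pi.mulSingle_apply, if_neg (by simpa using hne)]
    exact hh h1⟩
  map_one' := by
    refine Subtype.ext (RegularWreathProduct.ext ?_ rfl)
    simp
  map_mul' g g' := by
    refine Subtype.ext (RegularWreathProduct.ext ?_ (by simp))
    simp [Pi.mulSingle_mul]

/-- The embedding of `H` as the group of elements with trivial left component. -/
def topHom (G : Type u) (H : Type v) [Group G] [Group H] : H →* restrictedWreathProduct G H :=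
  RegularWreathProduct.inl.codRestrict _ fun h => by
    change {p : H | (RegularWreathProduct.inl h : RegularWreathProduct G H).left p ≠ 1}.Finite
    simp

theorem baseHom_left_one (g : G) : (baseHom G H g).1.left 1 = g := by simp [baseHom]

theorem baseHom_injective : Function.Injective (baseHom G H) := fun g g' h => by
  rw [← baseHom_left_one (H := H) g, h, baseHom_left_one]

theorem topHom_injective : Function.Injective (topHom G H) := fun _ _ heq =>
  congrArg (fun x : restrictedWreathProduct G H => x.1.right) heq

theorem fg_top_factor (h : Group.FG (restrictedWreathProduct G H)) : Group.FG H := by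
  have := h
  refine Group.fg_of_surjective
    (f := RegularWreathProduct.rightHom.comp (restrictedWreathProduct G H).subtype) fun x => ?_
  exact ⟨topHom G H x, rfl⟩

theorem fg_base_factor {n : ℕ} {a : Fin n → restrictedWreathProduct G H}
    (ha : IsSymmGenerating a) : Group.FG G := by
  let V : Set G := ⋃ i, Set.range (a i).1.left
  have hV : V.Finite := by
    refine Set.finite_iUnion fun i => ?_
    have hfin : ((a i).1.left '' {p | (a i).1.left p ≠ 1}).Finite := Set.Finite.image _ (a i).2
    refine (hfin.insert 1).subset ?_
    rintro _ ⟨p, rfl⟩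
    by_cases hp : (a i).1.left p = 1
    · exact Or.inl hp
    · exact Or.inr ⟨p, hp, rfl⟩
  refine Group.fg_iff.2 ⟨V, (Subgroup.eq_top_iff' _).2 fun g => ?_, hV⟩
  have key : ∀ (w : Word n) (p : H), (evalWord a w).1.left p ∈ Subgroup.closure V := by
    intro w
    induction w with
    | nil => exact fun p => Subgroup.one_mem _
    | cons i w ih =>
      intro p
      rw [evalWord_cons, Subgroup.coe_mul, left_mul_apply]
      exact Subgroup.mul_mem _ (Subgroup.subset_closure (Set.mem_iUnion.2 ⟨i, p, rfl⟩)) (ih _)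
  obtain ⟨w, hw⟩ := ha.2 (baseHom G H g)
  have := key w 1
  rwa [hw, baseHom_left_one] at this

/-- The letters of `G` and `H` as elements of the restricted wreath product. -/
noncomputable def restrictedLetter (aG : Fin nG → G) (aH : Fin nH → H) (i : Fin (nG + nH)) :
    restrictedWreathProduct G H :=
  Fin.addCases (fun i => baseHom G H (aG i)) (fun j => topHom G H (aH j)) i

theorem subtype_comp_restrictedLetter :
    (restrictedWreathProduct G H).subtype ∘ restrictedLetter aG aH = wreathLetter aG aH := by
  funext i
  cases i using Fin.addCases with
  | left i => simp [restrictedLetter, baseHom, wreathLetter_castAdd]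
  | right j =>
    rw [wreathLetter_natAdd]
    simp only [Function.comp_apply, restrictedLetter, Fin.addCases_right]
    rfl

open Classical in
theorem isSymmGenerating_restrictedLetter (hG : IsSymmGenerating aG) (hH : IsSymmGenerating aH) :
    IsSymmGenerating (restrictedLetter aG aH) := by
  constructor
  · intro i
    cases i using Fin.addCases with
    | left i =>
      obtain ⟨j, hj⟩ := hG.1 i
      exact ⟨Fin.castAdd nH j, by simp [restrictedLetter, hj]⟩
    | right i =>
      obtain ⟨j, hj⟩ := hH.1 i
      exact ⟨Fin.natAdd nG j, by simp [restrictedLetter, hj]⟩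
  let P : Submonoid (restrictedWreathProduct G H) :=
    { carrier := {x | ∃ w, evalWord (restrictedLetter aG aH) w = x}
      one_mem' := ⟨[], rfl⟩
      mul_mem' := by
        rintro _ _ ⟨w, rfl⟩ ⟨w', rfl⟩
        exact ⟨w ++ w', evalWord_append _ _ _⟩ }
  have hbase : ∀ g, baseHom G H g ∈ P := by
    intro g
    obtain ⟨w, rfl⟩ := hG.2 g
    refine ⟨w.map (Fin.castAdd nH), ?_⟩
    rw [← evalWord_comp]
    simp [evalWord, Function.comp_def, restrictedLetter]
  have htop : ∀ h, topHom G H h ∈ P := by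
    intro h
    obtain ⟨w, rfl⟩ := hH.2 h
    refine ⟨w.map (Fin.natAdd nG), ?_⟩
    rw [← evalWord_comp]
    simp [evalWord, Function.comp_def, restrictedLetter]
  -- Elements supported at a single position are conjugates of elements of the base group.
  have hsupp : ∀ (S : Finset H) (x : restrictedWreathProduct G H),
      (∀ p, x.1.left p ≠ 1 → p ∈ S) → x ∈ P := by
    intro S
    induction S using Finset.induction_on with
    | empty =>
      intro x hx
      have : x = topHom G H x.1.right := by
        refine Subtype.ext (RegularWreathProduct.ext (funext fun p => ?_) rfl)
        by_contra hne
        exact absurd (hx p hne) (Finset.notMem_empty p)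
      rw [this]
      exact htop _
    | insert p S hp ih =>
      intro x hx
      set y := topHom G H p * baseHom G H (x.1.left p) * topHom G H p⁻¹ with hy
      have hyP : y ∈ P := P.mul_mem (P.mul_mem (htop _) (hbase _)) (htop _)
      have hyr : y.1.right = 1 := by
        simp [hy, baseHom, topHom]
      have hyl : ∀ q, y.1.left q = if q = p then x.1.left p else 1 := by
        intro q
        simp only [hy, Subgroup.coe_mul, left_mul_apply]
        simp [baseHom, topHom, Pi.mulSingle_apply, inv_mul_eq_one, eq_comm]
      have hrest : y⁻¹ * x ∈ P := by
        refine ih _ fun q hq => ?_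
        have hval : (y⁻¹ * x).1.left q = (y.1.left q)⁻¹ * x.1.left q := by
          simp [left_mul_apply, hyr]
        rw [hval, hyl] at hq
        by_cases hqp : q = p
        · rw [if_pos hqp, hqp] at hq
          simp at hq
        · rw [if_neg hqp] at hq
          exact (Finset.mem_insert.1 (hx q (by simpa using hq))).resolve_left hqp
      have := P.mul_mem hyP hrest
      rwa [mul_inv_cancel_left] at this
  intro x
  exact hsupp x.2.toFinset x fun p hp => (Set.Finite.mem_toFinset _).2 hp

end Generators

end Knapsack

theorem mainTheorem1 (G : Type u) (H : Type v) [Group G] [Group H] :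
    Knapsack.IsKnapsackSemilinear (restrictedWreathProduct G H) ↔
      Knapsack.IsKnapsackSemilinear G ∧ Knapsack.IsKnapsackSemilinear H := by
  open Knapsack in
  constructor
  · intro h
    obtain ⟨n, a, ha, -⟩ := id h
    exact ⟨h.of_injective baseHom_injective (fg_base_factor ha),
      h.of_injective topHom_injective (fg_top_factor ha.fg)⟩
  · rintro ⟨⟨nG, aG, hGgen, hG⟩, ⟨nH, aH, hHgen, hH⟩⟩
    obtain ⟨βG, hβG, htG⟩ := hG.exists_tame
    obtain ⟨βH, hβH, htH⟩ := hH.exists_tame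
    obtain ⟨DG, hDG, hDG'⟩ := hG.exists_wordProblem
    obtain ⟨DH, hDH, hDH'⟩ := hH.exists_wordProblem
    obtain ⟨D, hD, hD'⟩ := exists_wordProblem_wreath hHgen.1 hDG hDH hDG' hDH'
    refine ⟨nG + nH, restrictedLetter aG aH, isSymmGenerating_restrictedLetter hGgen hHgen, ?_⟩
    rw [← isKnapsackSemilinearWith_comp_iff (restrictedWreathProduct G H).subtype_injective,
      subtype_comp_restrictedLetter]
    exact (htG.wreath htH hHgen.1).isKnapsackSemilinearWith (computable_wreathLevel hβG hβH) hD hD'
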